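/- For $n\ge 0$, let $S_n(2413,3142,P_4)$ be the set of permutations $\sigma=\sigma_1\cdots\sigma_n$ of $\{1,\dots,n\}$ that avoid the classical patterns $2413$ and $3142$ and the partially ordered pattern $P_4$, an occurrence of $P_4$ in $\sigma$ being a subsequence $\sigma_{i_1}\sigma_{i_2}\sigma_{i_3}\sigma_{i_4}$, $i_1<i_2<i_3<i_4$, whose last entry is larger than each of the other three. Let $\mathrm{asc}$, $\mathrm{des}$, $\mathrm{lrmax}$, $\mathrm{rlmax}$, $\mathrm{lrmin}$, $\mathrm{rlmin}$ be the numbers of ascents, descents, left-to-right maxima, right-to-left maxima, left-to-right minima and right-to-left minima of a permutation, and $$F_4(x,p,q,u,v,s,t)=\sum_{n\ge 0}x^n\sum_{\sigma\in S_n(2413,3142,P_4)}p^{\mathrm{asc}(\sigma)}q^{\mathrm{des}(\sigma)}u^{\mathrm{lrmax}(\sigma)}v^{\mathrm{rlmax}(\sigma)}s^{\mathrm{lrmin}(\sigma)}t^{\mathrm{rlmin}(\sigma)}.$$ Then, as formal power series in $x$ (the polynomial $F_b$ below is invertible as such), $$F_4(x,p,q,u,v,s,t)=\frac{F_a}{F_b},$$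 where \begin{align*} F_b ={}& 1 + q^4 s v^3 x^4 (v - p s x) - q v x (3 + s + p x + p s x + p^2 s x^2)\\ &- q^3 v^2 x^3 \left( v - p s^2 x (2 + p x ) + s v (3 + 2 p x) \right)\\ &+ q^2 v x^2 \Big( - p s^2 x + v \left(3 + p x + s (3 + 3 p x + p^2 x^2) \right) \Big),\\ F_a={}& 1 + q^4 s v^3 x^4 \left(v - p s x + p s^2 t u (-1 + t + u - t u) v x^2 \right)\\ &+ s t u v x (1 + p t u x + p^2 t^2 u^2 x^2)\\ &+ q^2 v x^2 \Big[- p s^2 x + s t u v^2 x \Big( 3 + p \big( 1 + 2 s (-1 + t) (-1 + u)+ t u \big) x \\ &\quad + p^2 (-1 + t ) (-1 + u) \big( t u + s (1 + t + u + 2 t u) \big) x^2 + p^3 s (-1 + t) t (-1 + u) u x^3 \Big)\\ &\quad + v \big(3 + p x - p s^2 t^2 u^2 x^2 (2 + p x) + s (3 +3 p x + p^2 x^2) - p s^3 (-1 + t ) t (-1 + u ) u x^2 (1 + p^2 t u x^2 ) \big)\Big]\\ &- q^3 v^2 x^3 \Big(-p s^2 x ( 2 + p x) + s t u v^2 x \big(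 1 + p s (-1 + t)(-1 + u) x +p^2 s (-1 + t) t (-1 + u) u x^2\big)\\ &\quad + v \big(1- p s^2 t^2 u^2 x^2 +s (3 + 2 p x ) - p s^3 (-1 + t ) t (-1 + u) u x^2 (2 + p x + p^2 t u x^2 ) \big) \Big)\\ &-q v x \Big[3 + p x + s \Big(1 + 3 t u v x + p x ( 1 + t u v x + 2 t^2 u^2 v x )\\ &\quad + p^2 x^2 \big(1 - t^2 (-1 + u) u^2 v x + t^3 u^2 (-1 + 2u) v x \big) \Big) \\ &\quad + p s^2 t u x^2 \Big( p t^2 (-1 + u) v x (1 + u + p u x) - (-1 + u) v \big(1 + p (1 + u) x\big)\\ &\quad - t \big( v + p^2 u^2 v x^2- u (-1 + v + p^2 v x^2 ) \big) \Big) \Big]. \end{align*} Expanded as polynomials in $x,p,q,u,v,s,t$ over $\mathbb{Z}$, $F_a$ has exactly $100$ monomials and $F_b$ exactly $19$. -/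

import Mathlib

open Finset

namespace SepPOP

/-! A permutation `π = π₁ ⋯ πₙ` of length `n` is an element `π : Equiv.Perm (Fin n)`; position `i`
carries the value `π i` (positions and values are counted from `0`). -/

/-- `π` contains the classical pattern given by the word `w` of length `k`: some subsequence of `π`
of length `k` is in the same relative order as `w`. -/
def Contains {n k : ℕ} (π : Equiv.Perm (Fin n)) (w : Fin k → ℕ) : Prop :=
  ∃ f : Fin k → Fin n, (∀ i j, i < j → f i < f j) ∧
    ∀ i j, π (f i) < π (f j) ↔ w i < w j

/-- `π` contains the partially ordered pattern given by the strict partial order `r` on the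
positions `Fin k`: in some subsequence of `π` of length `k`, the entry in position `i` is smaller
than the entry in position `j` whenever `r i j`; no condition is put on incomparable positions. -/
def ContainsPOP {n k : ℕ} (π : Equiv.Perm (Fin n)) (r : Fin k → Fin k → Prop) : Prop :=
  ∃ f : Fin k → Fin n, (∀ i j, i < j → f i < f j) ∧
    ∀ i j, r i j → π (f i) < π (f j)

/-- The partially ordered pattern `P_k`, `k ≥ 1`: the only relations are that each of the first
`k - 1` positions lies below the last one. -/
def popP (k : ℕ) (i j : Fin k) : Prop :=
  (i : ℕ) + 1 < k ∧ (j : ℕ) + 1 = k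

instance {n k : ℕ} (π : Equiv.Perm (Fin n)) (w : Fin k → ℕ) : Decidable (Contains π w) := by
  unfold Contains; infer_instance

instance {n k : ℕ} (π : Equiv.Perm (Fin n)) (r : Fin k → Fin k → Prop)
    [∀ i j, Decidable (r i j)] : Decidable (ContainsPOP π r) := by
  unfold ContainsPOP; infer_instance

instance (k : ℕ) (i j : Fin k) : Decidable (popP k i j) := by
  unfold popP; infer_instance

/-- `S_n(2413, 3142, P_k)`: the permutations of length `n` avoiding `2413`, `3142` and `P_k`. -/
def avoiders (k n : ℕ) : Finset (Equiv.Perm (Fin n)) :=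
  univ.filter fun π => ¬ Contains π ![2, 4, 1, 3] ∧ ¬ Contains π ![3, 1, 4, 2] ∧
    ¬ ContainsPOP π (popP k)

section Statistics

variable {n : ℕ} (π : Equiv.Perm (Fin n))

/-- The number of ascents. -/
def asc : ℕ := (univ.filter fun i : Fin n => ∃ j : Fin n, (j : ℕ) = i + 1 ∧ π i < π j).card

/-- The number of descents. -/
def des : ℕ := (univ.filter fun i : Fin n => ∃ j : Fin n, (j : ℕ) = i + 1 ∧ π j < π i).card

/-- The number of left-to-right maxima. -/
def lrmax : ℕ := (univ.filter fun i : Fin n => ∀ j, j < i → π j < π i).card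

/-- The number of right-to-left maxima. -/
def rlmax : ℕ := (univ.filter fun i : Fin n => ∀ j, i < j → π j < π i).card

/-- The number of left-to-right minima. -/
def lrmin : ℕ := (univ.filter fun i : Fin n => ∀ j, j < i → π i < π j).card

/-- The number of right-to-left minima. -/
def rlmin : ℕ := (univ.filter fun i : Fin n => ∀ j, i < j → π i < π j).card

end Statistics

/-- The generating function `F_k(x, p, q, u, v, s, t)`, `k ≥ 1`, as a formal power series in `x`
over a commutative ring containing `p, q, u, v, s, t`. -/
noncomputable def genF {R : Type*} [CommRing R] (k : ℕ) (p q u v s t : R) : PowerSeries R :=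
  PowerSeries.mk fun n => ∑ π ∈ avoiders k n,
    p ^ asc π * q ^ des π * u ^ lrmax π * v ^ rlmax π * s ^ lrmin π * t ^ rlmin π

/-- The denominator `F_b`. -/
def Fb {R : Type*} [CommRing R] (x p q _u v s _t : R) : R :=
  1 + q ^ 4 * s * v ^ 3 * x ^ 4 * (v - p * s * x)
    - q * v * x * (3 + s + p * x + p * s * x + p ^ 2 * s * x ^ 2)
    - q ^ 3 * v ^ 2 * x ^ 3 * (v - p * s ^ 2 * x * (2 + p * x) + s * v * (3 + 2 * p * x))
    + q ^ 2 * v * x ^ 2 *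
        (-(p * s ^ 2 * x) + v * (3 + p * x + s * (3 + 3 * p * x + p ^ 2 * x ^ 2)))

/-- The numerator `F_a`. -/
def Fa {R : Type*} [CommRing R] (x p q u v s t : R) : R :=
  1 + q ^ 4 * s * v ^ 3 * x ^ 4 *
        (v - p * s * x + p * s ^ 2 * t * u * (-1 + t + u - t * u) * v * x ^ 2)
    + s * t * u * v * x * (1 + p * t * u * x + p ^ 2 * t ^ 2 * u ^ 2 * x ^ 2)
    + q ^ 2 * v * x ^ 2 *
        (-(p * s ^ 2 * x)
          + s * t * u * v ^ 2 * x *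
              (3 + p * (1 + 2 * s * (-1 + t) * (-1 + u) + t * u) * x
                + p ^ 2 * (-1 + t) * (-1 + u) * (t * u + s * (1 + t + u + 2 * t * u)) * x ^ 2
                + p ^ 3 * s * (-1 + t) * t * (-1 + u) * u * x ^ 3)
          + v *
              (3 + p * x - p * s ^ 2 * t ^ 2 * u ^ 2 * x ^ 2 * (2 + p * x)
                + s * (3 + 3 * p * x + p ^ 2 * x ^ 2)
                - p * s ^ 3 * (-1 + t) * t * (-1 + u) * u * x ^ 2 * (1 + p ^ 2 * t * u * x ^ 2)))
    - q ^ 3 * v ^ 2 * x ^ 3 *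
        (-(p * s ^ 2 * x * (2 + p * x))
          + s * t * u * v ^ 2 * x *
              (1 + p * s * (-1 + t) * (-1 + u) * x
                + p ^ 2 * s * (-1 + t) * t * (-1 + u) * u * x ^ 2)
          + v *
              (1 - p * s ^ 2 * t ^ 2 * u ^ 2 * x ^ 2 + s * (3 + 2 * p * x)
                - p * s ^ 3 * (-1 + t) * t * (-1 + u) * u * x ^ 2 *
                    (2 + p * x + p ^ 2 * t * u * x ^ 2)))
    - q * v * x *
        (3 + p * x
          + s *
              (1 + 3 * t * u * v * x + p * x * (1 + t * u * v * x + 2 * t ^ 2 * u ^ 2 * v * x)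
                + p ^ 2 * x ^ 2 *
                    (1 - t ^ 2 * (-1 + u) * u ^ 2 * v * x + t ^ 3 * u ^ 2 * (-1 + 2 * u) * v * x))
          + p * s ^ 2 * t * u * x ^ 2 *
              (p * t ^ 2 * (-1 + u) * v * x * (1 + u + p * u * x)
                - (-1 + u) * v * (1 + p * (1 + u) * x)
                - t * (v + p ^ 2 * u ^ 2 * v * x ^ 2 - u * (-1 + v + p ^ 2 * v * x ^ 2))))

end SepPOP

/-!
Write permutations as words. A permutation that avoids `2413`, `3142` and `P_4` is a skew sum of
skew-indecomposable ones, and `P_4` leaves only three kinds of skew-indecomposable permutations: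
`1`, the direct sum `1 ⊕ β` with `β` a nonempty avoider of `2413`, `3142` and `P_3`, and `21 ⊕ δ`
with `δ` nonempty and decreasing (`Avoid4.exists_comp`, `Comp4.avoid4`). The avoiders of `P_3` are
in turn the skew sums of `1` and `1 ⊕ δ` with `δ` nonempty and decreasing, and the decreasing
permutations are the skew sums of `1`.

Splitting off the first skew component is unique (`skew_inj`). In a skew sum the cut is a descent,
right-to-left maxima and left-to-right minima add up, left-to-right maxima come from the first part
and right-to-left minima from the last (`wt_skew`). So the generating function `F` of the nonempty
avoiders and that of their first components, `K`, satisfy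
`F(u, t) = K(u, t) + q K(u, 1) F(1, t)` (`gf_nonempty`), for each of the three classes. Direct sums
obey the mirror rule (`wt_dsum`), which expresses `K` for one class by `F` for the smaller classes
(`gf_comp3`, `gf_comp4`). This linear system is triangular. Its denominators are units in the
ring of power series, and elimination gives `F_a / F_b` (`genF_mul_Fb`).

The monomials are counted on an explicit list of the terms of the expanded polynomials, with
distinct exponent vectors and nonzero coefficients (`card_support_sum_eval`).
-/

namespace SepPOP

/-! ### Statistics of words -/

/-- The number of pairs of adjacent letters `a b` of a word with `r a b`. -/
def adjCount (r : ℕ → ℕ → Prop) [DecidableRel r] : List ℕ → ℕ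
  | [] => 0
  | [_] => 0
  | a :: b :: l => (if r a b then 1 else 0) + adjCount r (b :: l)

/-- The number of letters `a` of a word such that `r b a` for every letter `b` to the right
of `a`. -/
def records (r : ℕ → ℕ → Prop) [DecidableRel r] : List ℕ → ℕ
  | [] => 0
  | a :: l => (if ∀ b ∈ l, r b a then 1 else 0) + records r l

section

variable (r : ℕ → ℕ → Prop) [DecidableRel r]

theorem adjCount_append_of_forall {l m : List ℕ} (hl : l ≠ []) (hm : m ≠ [])
    (h : ∀ a ∈ l, ∀ b ∈ m, r a b) :
    adjCount r (l ++ m) = adjCount r l + adjCount r m + 1 := by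
  induction l with
  | nil => exact absurd rfl hl
  | cons a l ih =>
    cases l with
    | nil =>
      cases m with
      | nil => exact absurd rfl hm
      | cons b m => simp [adjCount, h a (by simp) b (by simp)]; omega
    | cons a' l =>
      have := ih (by simp) (fun x hx => h x (List.mem_cons_of_mem _ hx))
      simp only [List.cons_append, adjCount] at this ⊢
      omega

theorem adjCount_append_of_forall_not {l m : List ℕ}
    (h : ∀ a ∈ l, ∀ b ∈ m, ¬ r a b) :
    adjCount r (l ++ m) = adjCount r l + adjCount r m := by
  induction l with
  | nil => simp [adjCount]
  | cons a l ih =>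
    cases l with
    | nil =>
      cases m with
      | nil => simp [adjCount]
      | cons b m => simp [adjCount, h a (by simp) b (by simp)]
    | cons a' l =>
      have := ih (fun x hx => h x (List.mem_cons_of_mem _ hx))
      simp only [List.cons_append, adjCount] at this ⊢
      omega

theorem records_append_of_forall {l m : List ℕ} (h : ∀ a ∈ l, ∀ b ∈ m, r b a) :
    records r (l ++ m) = records r l + records r m := by
  induction l with
  | nil => simp [records]
  | cons a l ih =>
    have := ih (fun x hx => h x (List.mem_cons_of_mem _ hx))
    have h' : (∀ b ∈ l ++ m, r b a) ↔ ∀ b ∈ l, r b a := by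
      constructor
      · exact fun H b hb => H b (List.mem_append_left _ hb)
      · intro H b hb
        rcases List.mem_append.1 hb with hb | hb
        · exact H b hb
        · exact h a (by simp) b hb
    simp only [List.cons_append, records, this, h']
    omega

theorem records_append_of_forall_not {l m : List ℕ} (hm : m ≠ [])
    (h : ∀ a ∈ l, ∀ b ∈ m, ¬ r b a) :
    records r (l ++ m) = records r m := by
  induction l with
  | nil => simp
  | cons a l ih =>
    obtain ⟨b, hb⟩ := List.exists_mem_of_ne_nil m hm
    have h' : ¬ ∀ b ∈ l ++ m, r b a := fun H =>
      h a (by simp) b hb (H b (List.mem_append_right _ hb))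
    rw [List.cons_append, records, if_neg h', zero_add]
    exact ih (fun x hx => h x (List.mem_cons_of_mem _ hx))

theorem adjCount_map (f : ℕ → ℕ) (hf : ∀ a b, r (f a) (f b) ↔ r a b) (l : List ℕ) :
    adjCount r (l.map f) = adjCount r l := by
  induction l with
  | nil => rfl
  | cons a l ih =>
    cases l with
    | nil => rfl
    | cons b l => simpa [adjCount, hf] using ih

theorem records_map (f : ℕ → ℕ) (hf : ∀ a b, r (f a) (f b) ↔ r a b) (l : List ℕ) :
    records r (l.map f) = records r l := by
  induction l with
  | nil => rfl
  | cons a l ih => simp [records, hf, ih]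

theorem card_filter_adjacent {n : ℕ} (f : Fin n → ℕ) :
    (univ.filter fun i : Fin n => ∃ j : Fin n, (j : ℕ) = i + 1 ∧ r (f i) (f j)).card =
      adjCount r (List.ofFn f) := by
  induction n with
  | zero => simp [adjCount]
  | succ n ih =>
    rw [Fin.card_filter_univ_succ]
    have key : (univ.filter ((fun i : Fin (n + 1) =>
        ∃ j : Fin (n + 1), (j : ℕ) = i + 1 ∧ r (f i) (f j)) ∘ Fin.succ)) =
        univ.filter fun i : Fin n =>
          ∃ j : Fin n, (j : ℕ) = i + 1 ∧ r (f i.succ) (f j.succ) := by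
      ext i
      simp [Fin.exists_fin_succ]
    simp only [Function.comp_def] at key
    have ih' := ih (fun i => f i.succ)
    cases n with
    | zero =>
      simp [adjCount]
    | succ n =>
      rw [List.ofFn_succ, List.ofFn_succ, adjCount, ← List.ofFn_succ (f := fun i => f i.succ), ← ih',
        ← key]
      have h0 : (∃ j : Fin (n + 2), (j : ℕ) = ((0 : Fin (n + 2)) : ℕ) + 1 ∧ r (f 0) (f j)) ↔
          r (f 0) (f (Fin.succ 0)) := by
        constructor
        · rintro ⟨j, hj, h⟩
          have : j = Fin.succ 0 := by ext; simpa using hj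
          rwa [this] at h
        · intro h
          exact ⟨Fin.succ 0, by simp, h⟩
      simp only [h0]
      split_ifs <;> simp [add_comm]

theorem card_filter_records {n : ℕ} (f : Fin n → ℕ) :
    (univ.filter fun i : Fin n => ∀ j, i < j → r (f j) (f i)).card =
      records r (List.ofFn f) := by
  induction n with
  | zero => simp [records]
  | succ n ih =>
    rw [Fin.card_filter_univ_succ, List.ofFn_succ, records, ← ih]
    simp only [Fin.forall_fin_succ, List.forall_mem_ofFn_iff]
    simp
    split_ifs <;> simp [add_comm]

theorem card_filter_records_reverse {n : ℕ} (f : Fin n → ℕ) :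
    (univ.filter fun i : Fin n => ∀ j, j < i → r (f j) (f i)).card =
      records r (List.ofFn f).reverse := by
  have hrev : (List.ofFn f).reverse = List.ofFn (fun i => f i.rev) := by
    apply List.ext_getElem
    · simp
    · intro i h1 h2
      simp [List.getElem_reverse, Fin.rev]
      congr 2
      simp at h2
      omega
  rw [hrev, ← card_filter_records]
  apply Finset.card_bij (fun i _ => i.rev)
  · intro i hi
    simp only [mem_filter, mem_univ, true_and] at hi ⊢
    intro j hj
    simpa using hi j.rev (by rwa [Fin.rev_lt_iff] )
  · intro a _ b _ h
    simpa using h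
  · intro i hi
    simp only [mem_filter, mem_univ, true_and] at hi ⊢
    refine ⟨i.rev, fun j hj => ?_, by simp⟩
    simpa using hi j.rev (by rwa [Fin.lt_rev_iff])

end

/-! ### Words of permutations -/

/-- The word `π₁ ⋯ πₙ` of a permutation. -/
def word {n : ℕ} (π : Equiv.Perm (Fin n)) : List ℕ := List.ofFn fun i => (π i : ℕ)

/-- The words of the permutations of length `n`. -/
def words (n : ℕ) : Finset (List ℕ) := univ.image (word : Equiv.Perm (Fin n) → List ℕ)

/-- A list of natural numbers is the word of a permutation of its length. -/
def IsPerm (l : List ℕ) : Prop := l.Nodup ∧ ∀ a ∈ l, a < l.length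

theorem word_injective {n : ℕ} : Function.Injective (word : Equiv.Perm (Fin n) → List ℕ) := by
  intro π ρ h
  ext i
  exact congrFun (List.ofFn_injective h) i

theorem mem_words {n : ℕ} {l : List ℕ} : l ∈ words n ↔ IsPerm l ∧ l.length = n := by
  constructor
  · intro h
    obtain ⟨π, -, rfl⟩ := Finset.mem_image.1 h
    refine ⟨⟨?_, ?_⟩, by simp [word]⟩
    · rw [word, List.nodup_ofFn]
      exact fun i j h => π.injective (Fin.ext h)
    · simp [word, List.mem_ofFn]
  · rintro ⟨⟨h1, h2⟩, rfl⟩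
    let f : Fin l.length → Fin l.length := fun i => ⟨l.get i, h2 _ (List.get_mem _ _)⟩
    have hf : Function.Injective f := fun i j hij => by
      have := congrArg Fin.val hij
      exact (List.nodup_iff_injective_get.1 h1) this
    refine Finset.mem_image.2 ⟨Equiv.ofBijective f (Finite.injective_iff_bijective.1 hf),
      mem_univ _, ?_⟩
    simp [word, f]

theorem IsPerm.mem {l : List ℕ} (h : IsPerm l) {a : ℕ} (ha : a < l.length) : a ∈ l := by
  have hs : l.toFinset = range l.length := by
    apply Finset.eq_of_subset_of_card_le
    · intro x hx
      exact mem_range.2 (h.2 x (List.mem_toFinset.1 hx))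
    · rw [card_range, List.toFinset_card_of_nodup h.1]
  exact List.mem_toFinset.1 (hs ▸ mem_range.2 ha)

theorem IsPerm.perm {l m : List ℕ} (h : IsPerm l) (e : l.Perm m) : IsPerm m :=
  ⟨e.nodup_iff.1 h.1, fun a ha => e.length_eq ▸ h.2 a (e.mem_iff.2 ha)⟩

/-- If the word of a permutation is cut in two parts, the first above the second, then each part
is the word of a permutation, the first one shifted. -/
theorem IsPerm.split {l m : List ℕ} (h : IsPerm (l ++ m)) (hlm : ∀ a ∈ l, ∀ b ∈ m, b < a) :
    IsPerm m ∧ ∃ c, IsPerm c ∧ l = c.map (· + m.length) := by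
  have hd := List.nodup_append.1 h.1
  have hb : ∀ a ∈ l, m.length ≤ a := by
    intro a ha
    have : m.toFinset ⊆ range a := fun b hb => mem_range.2 (hlm a ha b (List.mem_toFinset.1 hb))
    simpa [List.toFinset_card_of_nodup hd.2.1] using Finset.card_le_card this
  refine ⟨⟨hd.2.1, fun b hb => ?_⟩, l.map (· - m.length), ⟨?_, ?_⟩, ?_⟩
  · have : range (b + 1) ⊆ m.toFinset := by
      intro x hx
      have hx' : x ≤ b := by simpa [Nat.lt_succ_iff] using hx
      have hbl := h.2 b (by simp [hb])
      rcases List.mem_append.1 (h.mem (lt_of_le_of_lt hx' hbl)) with h1 | h1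
      · exact absurd (hlm x h1 b hb) (by omega)
      · simpa using h1
    simpa [List.toFinset_card_of_nodup hd.2.1] using Finset.card_le_card this
  · refine List.Nodup.map_on (fun x hx y hy hxy => ?_) hd.1
    have := hb x hx
    have := hb y hy
    omega
  · intro a ha
    obtain ⟨x, hx, rfl⟩ := List.mem_map.1 ha
    have h1 := h.2 x (by simp [hx])
    have h2 := hb x hx
    simp only [List.length_append, List.length_map] at h1 ⊢
    omega
  · rw [List.map_map]
    symm
    conv_rhs => rw [← List.map_id l]
    refine List.map_congr_left fun a ha => ?_
    have := hb a ha
    simp; omega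

/-- The skew sum of two words: the first is placed above and to the left of the second. -/
def skew (c τ : List ℕ) : List ℕ := c.map (· + τ.length) ++ τ

/-- The direct sum of two words: the first is placed below and to the left of the second. -/
def dsum (α β : List ℕ) : List ℕ := α ++ β.map (· + α.length)

theorem length_skew (c τ : List ℕ) : (skew c τ).length = c.length + τ.length := by simp [skew]

theorem length_dsum (c τ : List ℕ) : (dsum c τ).length = c.length + τ.length := by simp [dsum]

theorem lt_of_mem_shift {c τ : List ℕ} (hτ : IsPerm τ) :
    ∀ a ∈ c.map (· + τ.length), ∀ b ∈ τ, b < a := by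
  intro a ha b hb
  obtain ⟨x, -, rfl⟩ := List.mem_map.1 ha
  have := hτ.2 b hb
  omega

theorem IsPerm.skew {c τ : List ℕ} (hc : IsPerm c) (hτ : IsPerm τ) : IsPerm (skew c τ) := by
  constructor
  · refine List.Nodup.append (hc.1.map (add_left_injective _)) hτ.1 fun a ha hb => ?_
    exact lt_irrefl _ (lt_of_mem_shift hτ a ha a hb)
  · intro a ha
    rw [length_skew]
    rcases List.mem_append.1 ha with ha | ha
    · obtain ⟨x, hx, rfl⟩ := List.mem_map.1 ha
      have := hc.2 x hx
      omega
    · have := hτ.2 a ha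
      omega

theorem IsPerm.dsum {α β : List ℕ} (hα : IsPerm α) (hβ : IsPerm β) : IsPerm (dsum α β) :=
  (hβ.skew hα).perm List.perm_append_comm

/-! ### The classes of words -/

/-- The words without occurrences of `2413`, `3142` and `P_4`. -/
def Avoid4 (l : List ℕ) : Prop :=
  ∀ a b c d, [a, b, c, d].Sublist l →
    ¬ (c < a ∧ a < d ∧ d < b) ∧ ¬ (b < d ∧ d < a ∧ a < c) ∧ ¬ (a < d ∧ b < d ∧ c < d)

/-- The words without occurrences of `P_3`: no letter has two smaller letters to its left. -/
def Avoid3 (l : List ℕ) : Prop :=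
  Avoid4 l ∧ ∀ a b c, [a, b, c].Sublist l → ¬ (a < c ∧ b < c)

/-- The decreasing words, that is, the words without occurrences of `P_2`. -/
def Avoid2 (l : List ℕ) : Prop := l.Pairwise (· > ·)

theorem Avoid4.sublist {l m : List ℕ} (h : Avoid4 m) (hs : l.Sublist m) : Avoid4 l :=
  fun a b c d H => h a b c d (H.trans hs)

theorem Avoid3.sublist {l m : List ℕ} (h : Avoid3 m) (hs : l.Sublist m) : Avoid3 l :=
  ⟨h.1.sublist hs, fun a b c H => h.2 a b c (H.trans hs)⟩

theorem avoid2_iff {l : List ℕ} : Avoid2 l ↔ ∀ a b, [a, b].Sublist l → b < a :=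
  List.pairwise_iff_forall_sublist

theorem Avoid2.avoid3 {l : List ℕ} (h : Avoid2 l) : Avoid3 l := by
  refine ⟨fun a b c d H => ?_, fun a b c H => ?_⟩
  · have h' := h.sublist H
    simp at h'
    omega
  · have h' := h.sublist H
    simp at h'
    omega

theorem avoid4_map {l : List ℕ} {k : ℕ} : Avoid4 (l.map (· + k)) ↔ Avoid4 l := by
  constructor
  · intro h a b c d H
    have := h (a + k) (b + k) (c + k) (d + k) (H.map (· + k))
    omega
  · intro h a b c d H
    obtain ⟨m, hm, e⟩ := List.sublist_map_iff.1 H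
    obtain ⟨a', m, rfl, rfl, e₁⟩ := List.map_eq_cons_iff.1 e.symm
    obtain ⟨b', m, rfl, rfl, e₂⟩ := List.map_eq_cons_iff.1 e₁
    obtain ⟨c', m, rfl, rfl, e₃⟩ := List.map_eq_cons_iff.1 e₂
    obtain ⟨d', m, rfl, rfl, e₄⟩ := List.map_eq_cons_iff.1 e₃
    obtain rfl := List.map_eq_nil_iff.1 e₄
    have := h _ _ _ _ hm
    omega

theorem avoid3_map {l : List ℕ} {k : ℕ} : Avoid3 (l.map (· + k)) ↔ Avoid3 l := by
  refine and_congr avoid4_map ⟨?_, ?_⟩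
  · intro h a b c H
    have := h (a + k) (b + k) (c + k) (H.map (· + k))
    omega
  · intro h a b c H
    obtain ⟨m, hm, e⟩ := List.sublist_map_iff.1 H
    obtain ⟨a', m, rfl, rfl, e₁⟩ := List.map_eq_cons_iff.1 e.symm
    obtain ⟨b', m, rfl, rfl, e₂⟩ := List.map_eq_cons_iff.1 e₁
    obtain ⟨c', m, rfl, rfl, e₃⟩ := List.map_eq_cons_iff.1 e₂
    obtain rfl := List.map_eq_nil_iff.1 e₃
    have := h _ _ _ hm
    omega

theorem avoid2_map {l : List ℕ} {k : ℕ} : Avoid2 (l.map (· + k)) ↔ Avoid2 l := by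
  simp [Avoid2, List.pairwise_map]

/-- None of the three patterns is a skew sum, so no occurrence straddles the cut of a skew sum. -/
theorem avoid4_append {l m : List ℕ} (h : ∀ a ∈ l, ∀ b ∈ m, b < a) :
    Avoid4 (l ++ m) ↔ Avoid4 l ∧ Avoid4 m := by
  refine ⟨fun H => ⟨H.sublist (List.sublist_append_left _ _),
    H.sublist (List.sublist_append_right _ _)⟩, fun ⟨hl, hm⟩ a b c d H => ?_⟩
  obtain ⟨l', m', e, h1, h2⟩ := List.sublist_append_iff.1 H
  have hlm : ∀ x ∈ l', ∀ y ∈ m', y < x := fun x hx y hy => h x (h1.subset hx) y (h2.subset hy)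
  rcases l' with _ | ⟨a', _ | ⟨b', _ | ⟨c', _ | ⟨d', l'⟩⟩⟩⟩
  · simp at e; subst e; exact hm _ _ _ _ h2
  · simp at e; obtain ⟨rfl, rfl⟩ := e; simp at hlm; omega
  · simp at e; obtain ⟨rfl, rfl, rfl⟩ := e; simp at hlm; omega
  · simp at e; obtain ⟨rfl, rfl, rfl, rfl⟩ := e; simp at hlm; omega
  · simp at e; obtain ⟨rfl, rfl, rfl, rfl, rfl, rfl⟩ := e; exact hl _ _ _ _ h1

theorem avoid3_append {l m : List ℕ} (h : ∀ a ∈ l, ∀ b ∈ m, b < a) :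
    Avoid3 (l ++ m) ↔ Avoid3 l ∧ Avoid3 m := by
  refine ⟨fun H => ⟨H.sublist (List.sublist_append_left _ _),
    H.sublist (List.sublist_append_right _ _)⟩, fun ⟨hl, hm⟩ =>
    ⟨(avoid4_append h).2 ⟨hl.1, hm.1⟩, fun a b c H => ?_⟩⟩
  obtain ⟨l', m', e, h1, h2⟩ := List.sublist_append_iff.1 H
  have hlm : ∀ x ∈ l', ∀ y ∈ m', y < x := fun x hx y hy => h x (h1.subset hx) y (h2.subset hy)
  rcases l' with _ | ⟨a', _ | ⟨b', _ | ⟨c', l'⟩⟩⟩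
  · simp at e; subst e; exact hm.2 _ _ _ h2
  · simp at e; obtain ⟨rfl, rfl⟩ := e; simp at hlm; omega
  · simp at e; obtain ⟨rfl, rfl, rfl⟩ := e; simp at hlm; omega
  · simp at e; obtain ⟨rfl, rfl, rfl, rfl, rfl⟩ := e; exact hl.2 _ _ _ h1

theorem avoid2_append {l m : List ℕ} (h : ∀ a ∈ l, ∀ b ∈ m, b < a) :
    Avoid2 (l ++ m) ↔ Avoid2 l ∧ Avoid2 m := by
  rw [Avoid2, List.pairwise_append]
  exact ⟨fun H => ⟨H.1, H.2.1⟩, fun H => ⟨H.1, H.2, h⟩⟩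

/-- A new least first letter turns an occurrence of `P_3` into one of `P_4`, and it takes part in
no occurrence of `2413` or `3142`. -/
theorem avoid4_cons_of_lt {a : ℕ} {β : List ℕ} (h : ∀ b ∈ β, a < b) :
    Avoid4 (a :: β) ↔ Avoid3 β := by
  constructor
  · refine fun H => ⟨H.sublist (List.sublist_cons_self _ _), fun b c d hs => ?_⟩
    have h1 := H a b c d (hs.cons_cons a)
    have h2 := h d (hs.subset (by simp))
    omega
  · intro H x b c d hs
    rcases List.cons_sublist_cons'.1 hs with hs' | ⟨rfl, hs'⟩
    · exact H.1 _ _ _ _ hs'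
    · have h1 := H.2 _ _ _ hs'
      have h2 := h b (hs'.subset (by simp))
      have h3 := h c (hs'.subset (by simp))
      omega

theorem avoid3_cons_of_lt {a : ℕ} {β : List ℕ} (h : ∀ b ∈ β, a < b) (hn : β.Nodup) :
    Avoid3 (a :: β) ↔ Avoid2 β := by
  constructor
  · refine fun H => avoid2_iff.2 fun c d hs => ?_
    have h1 := H.2 a c d (hs.cons_cons a)
    have h2 := h d (hs.subset (by simp))
    have h3 := hn.sublist hs
    simp at h3
    omega
  · intro H
    refine ⟨(avoid4_cons_of_lt h).2 H.avoid3, fun x c d hs => ?_⟩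
    rcases List.cons_sublist_cons'.1 hs with hs' | ⟨rfl, hs'⟩
    · exact H.avoid3.2 _ _ _ hs'
    · have := avoid2_iff.1 H _ _ hs'
      omega

/-- Two letters below and to the left of `δ` turn every ascending pair of `δ` into a `P_4`. -/
theorem avoid4_cons_cons_of_lt {a b : ℕ} {δ : List ℕ} (hab : b < a) (h : ∀ x ∈ δ, a < x)
    (hn : δ.Nodup) : Avoid4 (a :: b :: δ) ↔ Avoid2 δ := by
  constructor
  · refine fun H => avoid2_iff.2 fun c d hs => ?_
    have h1 := H a b c d ((hs.cons_cons b).cons_cons a)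
    have h2 := h d (hs.subset (by simp))
    have h3 := hn.sublist hs
    simp at h3
    omega
  · intro H x y c d hs
    have h4 := H.avoid3.1 x y c d
    rcases List.cons_sublist_cons'.1 hs with hs₁ | ⟨rfl, hs₁⟩
    · rcases List.cons_sublist_cons'.1 hs₁ with hs₂ | ⟨rfl, hs₂⟩
      · exact h4 hs₂
      · have h1 := H.avoid3.2 _ _ _ hs₂
        have h2 := h c (hs₂.subset (by simp))
        have h3 := h y (hs₂.subset (by simp))
        omega
    · have h5 : [c, d].Sublist δ := by
        rcases List.cons_sublist_cons'.1 hs₁ with hs₂ | ⟨e, hs₂⟩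
        · exact (List.sublist_cons_self _ _).trans hs₂
        · exact hs₂
      have h1 := avoid2_iff.1 H _ _ h5
      have h2 := h c (h5.subset (by simp))
      have h3 := h d (h5.subset (by simp))
      omega

/-! ### The first skew component -/

/-- A word in which no letter below `a` precedes a letter above `a` is cut by `a` in two parts. -/
theorem exists_append_of_forall_sublist {a : ℕ} {m : List ℕ} (ha : a ∉ m)
    (h : ∀ x y, [x, y].Sublist m → x < a → ¬ a < y) :
    ∃ β τ, m = β ++ τ ∧ (∀ x ∈ β, a < x) ∧ ∀ x ∈ τ, x < a := by
  induction m with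
  | nil => exact ⟨[], [], rfl, by simp, by simp⟩
  | cons b m ih =>
    simp only [List.mem_cons, not_or] at ha
    rcases lt_or_gt_of_ne ha.1 with hb | hb
    · obtain ⟨β, τ, rfl, h1, h2⟩ := ih ha.2 fun x y hs => h x y (hs.cons _)
      exact ⟨b :: β, τ, rfl, by simpa using ⟨hb, h1⟩, h2⟩
    · refine ⟨[], b :: m, rfl, by simp, fun x hx => ?_⟩
      rcases List.mem_cons.1 hx with rfl | hx
      · exact hb
      · have := h b x (by simpa using hx) hb
        have : x ≠ a := fun e => ha.2 (e ▸ hx)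
        omega

/-- The possible first skew components of a nonempty decreasing word: one letter. -/
def Comp2 (l : List ℕ) : Prop := ∃ a, l = [a]

/-- The possible first skew components of a nonempty word of `Avoid3`: one letter, or a letter and
a nonempty decreasing word above it. -/
def Comp3 (l : List ℕ) : Prop :=
  Comp2 l ∨ ∃ a β, l = a :: β ∧ β ≠ [] ∧ (∀ b ∈ β, a < b) ∧ Avoid2 β

/-- The possible first skew components of a nonempty word of `Avoid4`: one letter, a letter and a
nonempty word of `Avoid3` above it, or a descent and a nonempty decreasing word above it. -/
def Comp4 (l : List ℕ) : Prop :=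
  Comp2 l ∨ (∃ a β, l = a :: β ∧ β ≠ [] ∧ (∀ b ∈ β, a < b) ∧ Avoid3 β) ∨
    ∃ a b δ, l = a :: b :: δ ∧ δ ≠ [] ∧ b < a ∧ (∀ x ∈ δ, a < x) ∧ Avoid2 δ

theorem Avoid2.exists_comp {l : List ℕ} (h : Avoid2 l) (h0 : l ≠ []) :
    ∃ c τ, l = c ++ τ ∧ (∀ a ∈ c, ∀ b ∈ τ, b < a) ∧ Comp2 c ∧ Avoid2 τ := by
  obtain ⟨a, m, rfl⟩ := List.exists_cons_of_ne_nil h0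
  obtain ⟨h1, h2⟩ := List.pairwise_cons.1 h
  exact ⟨[a], m, rfl, by simpa using h1, ⟨a, rfl⟩, h2⟩

/-- The first component consists of the letters from the first one upwards. -/
theorem Avoid3.exists_comp {l : List ℕ} (h : Avoid3 l) (hn : l.Nodup) (h0 : l ≠ []) :
    ∃ c τ, l = c ++ τ ∧ (∀ a ∈ c, ∀ b ∈ τ, b < a) ∧ Comp3 c ∧ Avoid3 τ := by
  obtain ⟨a, m, rfl⟩ := List.exists_cons_of_ne_nil h0
  obtain ⟨han, hmn⟩ := List.nodup_cons.1 hn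
  by_cases hm : ∀ x ∈ m, x < a
  · exact ⟨[a], m, rfl, by simpa using hm, .inl ⟨a, rfl⟩, h.sublist (List.sublist_cons_self _ _)⟩
  · push Not at hm
    obtain ⟨x, hx, hax⟩ := hm
    have hax : a < x := lt_of_le_of_ne hax fun e => han (e ▸ hx)
    obtain ⟨β, τ, rfl, hβ, hτ⟩ := exists_append_of_forall_sublist han fun y z hs h1 h2 => by
      have := h.2 a y z (hs.cons_cons a)
      omega
    have hd := List.nodup_append.1 hmn
    refine ⟨a :: β, τ, rfl, ?_, .inr ⟨a, β, rfl, ?_, hβ, ?_⟩, h.sublist ?_⟩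
    · intro y hy z hz
      have := hτ z hz
      rcases List.mem_cons.1 hy with rfl | hy
      · exact this
      · exact this.trans (hβ y hy)
    · rintro rfl
      have := hτ x (by simpa using hx)
      omega
    · exact (avoid3_cons_of_lt hβ hd.1).1
        (h.sublist ((List.sublist_append_left β τ).cons_cons a))
    · exact (List.sublist_append_right _ _).cons _

/-- The first component starts with the first letter `a`. If some letter exceeds `a`, the component
is either all letters from `a` upwards, or these together with the second letter `b < a`. -/
theorem Avoid4.exists_comp {l : List ℕ} (h : Avoid4 l) (hn : l.Nodup) (h0 : l ≠ []) :
    ∃ c τ, l = c ++ τ ∧ (∀ a ∈ c, ∀ b ∈ τ, b < a) ∧ Comp4 c ∧ Avoid4 τ := by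
  obtain ⟨a, m, rfl⟩ := List.exists_cons_of_ne_nil h0
  obtain ⟨han, hmn⟩ := List.nodup_cons.1 hn
  by_cases hm : ∀ x ∈ m, x < a
  · exact ⟨[a], m, rfl, by simpa using hm, .inl ⟨a, rfl⟩, h.sublist (List.sublist_cons_self _ _)⟩
  · push Not at hm
    obtain ⟨x, hx, hax⟩ := hm
    have hax : a < x := lt_of_le_of_ne hax fun e => han (e ▸ hx)
    obtain ⟨b, m, rfl⟩ := List.exists_cons_of_ne_nil (List.ne_nil_of_mem hx)
    have hab : a ≠ b := fun e => han (by simp [e])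
    rcases lt_or_gt_of_ne hab with hab | hab
    · obtain ⟨β, τ, e, hβ, hτ⟩ := exists_append_of_forall_sublist han fun y z hs h1 h2 => by
        -- `a b y z` is an occurrence of `2413` if `z < b` and of `P_4` if `b < z`
        have hs' : [y, z].Sublist m := by
          rcases List.cons_sublist_cons'.1 hs with hs | ⟨rfl, hs⟩
          · exact hs
          · omega
        have := h a b y z ((hs'.cons_cons b).cons_cons a)
        have hbz : b ≠ z := fun e => (List.nodup_cons.1 hmn).1 (e ▸ hs'.subset (by simp))
        omega
      rw [e] at h hmn hx ⊢
      have hb : b ∈ β := by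
        rcases List.mem_append.1 (e ▸ List.mem_cons_self : b ∈ β ++ τ) with hb | hb
        · exact hb
        · have := hτ b hb
          omega
      refine ⟨a :: β, τ, rfl, ?_, .inr (.inl ⟨a, β, rfl, List.ne_nil_of_mem hb, hβ, ?_⟩),
        h.sublist ?_⟩
      · intro y hy z hz
        have := hτ z hz
        rcases List.mem_cons.1 hy with rfl | hy
        · exact this
        · exact this.trans (hβ y hy)
      · exact (avoid4_cons_of_lt hβ).1
          (h.sublist ((List.sublist_append_left β τ).cons_cons a))
      · exact (List.sublist_append_right _ _).cons _
    · have hxm : x ∈ m := by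
        rcases List.mem_cons.1 hx with rfl | hx
        · omega
        · exact hx
      obtain ⟨hbm, hmn⟩ := List.nodup_cons.1 hmn
      have ham : a ∉ m := fun H => han (by simp [H])
      -- no letter lies between `b` and `a`: to the right of `x` it would complete a `3142`,
      -- to the left of `x` a `P_4`
      have hgap : ∀ y ∈ m, y < a → y < b := by
        intro y hy hya
        by_contra hby
        have hby : b ≠ y := fun e => hbm (e ▸ hy)
        obtain ⟨m₁, m₂, rfl⟩ := List.append_of_mem hxm
        rcases List.mem_append.1 hy with hy | hy
        · have hs : [y, x].Sublist (m₁ ++ x :: m₂) :=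
            List.Sublist.append (List.singleton_sublist.2 hy)
              (List.singleton_sublist.2 List.mem_cons_self)
          have := h a b y x ((hs.cons_cons b).cons_cons a)
          omega
        · have hs : [x, y].Sublist (m₁ ++ x :: m₂) := by
            refine List.Sublist.trans ?_ (List.sublist_append_right _ _)
            rcases List.mem_cons.1 hy with rfl | hy
            · omega
            · exact (List.singleton_sublist.2 hy).cons_cons x
          have := h a b x y ((hs.cons_cons b).cons_cons a)
          omega
      obtain ⟨δ, τ, rfl, hδ, hτ⟩ := exists_append_of_forall_sublist ham fun y z hs h1 h2 => by
        have := h a b y z ((hs.cons_cons b).cons_cons a)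
        omega
      have hd := List.nodup_append.1 hmn
      refine ⟨a :: b :: δ, τ, rfl, ?_, .inr (.inr ⟨a, b, δ, rfl, ?_, hab, hδ, ?_⟩), h.sublist ?_⟩
      · intro y hy z hz
        have h1 := hτ z hz
        have h2 := hgap z (List.mem_append_right _ hz) h1
        rcases List.mem_cons.1 hy with rfl | hy
        · exact h1
        rcases List.mem_cons.1 hy with rfl | hy
        · exact h2
        · exact h1.trans (hδ y hy)
      · rintro rfl
        have := hτ x (by simpa using hxm)
        omega
      · exact (avoid4_cons_cons_of_lt hab hδ hd.1).1
          (h.sublist (((List.sublist_append_left δ τ).cons_cons b).cons_cons a))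
      · exact ((List.sublist_append_right _ _).cons _).cons _

theorem Comp2.avoid2 {l : List ℕ} (h : Comp2 l) : Avoid2 l := by
  obtain ⟨a, rfl⟩ := h
  simp [Avoid2]

theorem Comp3.avoid3 {l : List ℕ} (h : Comp3 l) (hn : l.Nodup) : Avoid3 l := by
  rcases h with h | ⟨a, β, rfl, -, h1, h2⟩
  · exact h.avoid2.avoid3
  · exact (avoid3_cons_of_lt h1 (List.nodup_cons.1 hn).2).2 h2

theorem Comp4.avoid4 {l : List ℕ} (h : Comp4 l) (hn : l.Nodup) : Avoid4 l := by
  rcases h with h | ⟨a, β, rfl, -, h1, h2⟩ | ⟨a, b, δ, rfl, -, hab, h1, h2⟩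
  · exact h.avoid2.avoid3.1
  · exact (avoid4_cons_of_lt h1).2 h2
  · exact (avoid4_cons_cons_of_lt hab h1 (List.nodup_cons.1 (List.nodup_cons.1 hn).2).2).2 h2

/-! ### Indecomposable words -/

/-- A word is skew-indecomposable if it is nonempty and cannot be cut in two nonempty parts, the
first above the second. -/
def SkewIndec (l : List ℕ) : Prop :=
  l ≠ [] ∧ ∀ a b, l = a ++ b → a ≠ [] → b ≠ [] → ∃ x ∈ a, ∃ y ∈ b, x ≤ y

theorem skewIndec_singleton (a : ℕ) : SkewIndec [a] := by
  refine ⟨by simp, fun l m h hl hm => ?_⟩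
  have := congrArg List.length h
  have := List.length_pos_iff.2 hl
  have := List.length_pos_iff.2 hm
  simp at *
  omega

theorem skewIndec_of_le_getLast {x : ℕ} {m : List ℕ} (hm : m ≠ []) (h : x ≤ m.getLast hm) :
    SkewIndec (x :: m) := by
  refine ⟨by simp, fun a b e ha hb => ?_⟩
  obtain ⟨y, a, rfl⟩ := List.exists_cons_of_ne_nil ha
  obtain ⟨rfl, rfl⟩ := List.cons_eq_cons.1 e
  have h : x ≤ (a ++ b).getLast hm := h
  rw [List.getLast_append_of_ne_nil hm hb] at h
  exact ⟨x, List.mem_cons_self, _, List.getLast_mem hb, h⟩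

theorem SkewIndec.map {l : List ℕ} (h : SkewIndec l) (k : ℕ) : SkewIndec (l.map (· + k)) := by
  refine ⟨by simpa using h.1, fun a b e ha hb => ?_⟩
  obtain ⟨a', b', rfl, rfl, rfl⟩ := List.map_eq_append_iff.1 e
  obtain ⟨x, hx, y, hy, hxy⟩ := h.2 a' b' rfl (by simpa using ha) (by simpa using hb)
  exact ⟨x + k, List.mem_map_of_mem hx, y + k, List.mem_map_of_mem hy, by omega⟩

theorem Comp2.skewIndec {l : List ℕ} (h : Comp2 l) : SkewIndec l := by
  obtain ⟨a, rfl⟩ := h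
  exact skewIndec_singleton a

theorem Comp3.skewIndec {l : List ℕ} (h : Comp3 l) : SkewIndec l := by
  rcases h with h | ⟨a, β, rfl, h0, h1, -⟩
  · exact h.skewIndec
  · exact skewIndec_of_le_getLast h0 (h1 _ (List.getLast_mem h0)).le

theorem Comp4.skewIndec {l : List ℕ} (h : Comp4 l) : SkewIndec l := by
  rcases h with h | ⟨a, β, rfl, h0, h1, -⟩ | ⟨a, b, δ, rfl, h0, -, h1, -⟩
  · exact h.skewIndec
  · exact skewIndec_of_le_getLast h0 (h1 _ (List.getLast_mem h0)).le
  · refine skewIndec_of_le_getLast (by simp) ?_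
    rw [List.getLast_cons h0]
    exact (h1 _ (List.getLast_mem h0)).le

/-- The first skew component and the rest are determined by their skew sum. -/
theorem skew_inj {c c' τ τ' : List ℕ} (hc : SkewIndec c) (hc' : SkewIndec c') (hτ : IsPerm τ)
    (hτ' : IsPerm τ') (e : skew c τ = skew c' τ') : c = c' ∧ τ = τ' := by
  have key : ∀ {c c' τ τ' : List ℕ}, SkewIndec c → SkewIndec c' → IsPerm τ → ∀ m,
      c'.map (· + τ'.length) = c.map (· + τ.length) ++ m → τ = m ++ τ' → c = c' ∧ τ = τ' := by
    intro c c' τ τ' hc hc' hτ m e1 e2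
    by_cases hm : m = []
    · subst hm
      simp only [List.nil_append, List.append_nil] at e1 e2
      subst e2
      exact ⟨(List.map_injective_iff.2 (add_left_injective _) e1).symm, rfl⟩
    · obtain ⟨x, hx, y, hy, hxy⟩ := (hc'.map τ'.length).2 _ _ e1 (by simpa using hc.1) hm
      have := lt_of_mem_shift hτ x hx y (by rw [e2]; exact List.mem_append_left _ hy)
      omega
  rcases List.append_eq_append_iff.1 e with ⟨m, h1, h2⟩ | ⟨m, h1, h2⟩
  · exact key hc hc' hτ m h1 h2
  · have := key hc' hc hτ' m h1 h2
    exact ⟨this.1.symm, this.2.symm⟩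

/-! ### Weights and generating functions -/

section

variable {R : Type*} [CommRing R]

/-- The weight `p^asc q^des u^lrmax v^rlmax s^lrmin t^rlmin` of a word. -/
def wt (p q u v s t : R) (l : List ℕ) : R :=
  p ^ adjCount (· < ·) l * q ^ adjCount (· > ·) l * u ^ records (· < ·) l.reverse *
    v ^ records (· < ·) l * s ^ records (· > ·) l.reverse * t ^ records (· > ·) l

theorem wt_map (p q u v s t : R) (l : List ℕ) (k : ℕ) :
    wt p q u v s t (l.map (· + k)) = wt p q u v s t l := by
  simp only [wt, ← List.map_reverse]
  rw [adjCount_map, adjCount_map, records_map, records_map, records_map, records_map] <;>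
    intros <;> omega

/-- Weight of a skew sum: the cut is a descent, the left-to-right maxima are those of the first
part, the right-to-left minima those of the second, and the other two statistics add up. -/
theorem wt_append_of_gt (p q u v s t : R) {l m : List ℕ} (hl : l ≠ []) (hm : m ≠ [])
    (h : ∀ a ∈ l, ∀ b ∈ m, b < a) :
    wt p q u v s t (l ++ m) = q * wt p q u v s 1 l * wt p q 1 v s t m := by
  have h' : ∀ a ∈ l, ∀ b ∈ m, ¬ a < b := fun a ha b hb => (h a ha b hb).not_gt
  simp only [wt, List.reverse_append]
  rw [adjCount_append_of_forall_not (· < ·) h', adjCount_append_of_forall (· > ·) hl hm h,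
    records_append_of_forall (· < ·) h,
    records_append_of_forall_not (· > ·) hm h',
    records_append_of_forall_not (· < ·) (l := m.reverse) (m := l.reverse) (by simpa using hl)
      (fun a ha b hb => h' b (by simpa using hb) a (by simpa using ha)),
    records_append_of_forall (· > ·) (l := m.reverse) (m := l.reverse)
      (fun a ha b hb => h b (by simpa using hb) a (by simpa using ha))]
  ring

/-- Weight of a direct sum: the cut is an ascent, the right-to-left maxima are those of the second
part, the left-to-right minima those of the first, and the other two statistics add up. -/
theorem wt_append_of_lt (p q u v s t : R) {l m : List ℕ} (hl : l ≠ []) (hm : m ≠ [])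
    (h : ∀ a ∈ l, ∀ b ∈ m, a < b) :
    wt p q u v s t (l ++ m) = p * wt p q u 1 s t l * wt p q u v 1 t m := by
  have h' : ∀ a ∈ l, ∀ b ∈ m, ¬ a > b := fun a ha b hb => (h a ha b hb).not_gt
  simp only [wt, List.reverse_append]
  rw [adjCount_append_of_forall_not (· > ·) h', adjCount_append_of_forall (· < ·) hl hm h,
    records_append_of_forall (· > ·) h,
    records_append_of_forall_not (· < ·) hm h',
    records_append_of_forall_not (· > ·) (l := m.reverse) (m := l.reverse) (by simpa using hl)
      (fun a ha b hb => h' b (by simpa using hb) a (by simpa using ha)),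
    records_append_of_forall (· < ·) (l := m.reverse) (m := l.reverse)
      (fun a ha b hb => h b (by simpa using hb) a (by simpa using ha))]
  ring

theorem wt_skew (p q u v s t : R) {c τ : List ℕ} (hc : c ≠ []) (hτ : τ ≠ []) (h : IsPerm τ) :
    wt p q u v s t (skew c τ) = q * wt p q u v s 1 c * wt p q 1 v s t τ := by
  rw [skew, wt_append_of_gt _ _ _ _ _ _ (by simpa using hc) hτ (lt_of_mem_shift h), wt_map]

theorem wt_dsum (p q u v s t : R) {α β : List ℕ} (hα : α ≠ []) (hβ : β ≠ []) (h : IsPerm α) :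
    wt p q u v s t (dsum α β) = p * wt p q u 1 s t α * wt p q u v 1 t β := by
  rw [dsum, wt_append_of_lt _ _ _ _ _ _ hα (by simpa using hβ)
    (fun a ha b hb => lt_of_mem_shift h b hb a ha), wt_map]

open Classical in
/-- The generating function by length, with weights `w`, of the words of permutations that
satisfy `C`. -/
noncomputable def gf (w : List ℕ → R) (C : List ℕ → Prop) : PowerSeries R :=
  PowerSeries.mk fun n => ∑ l ∈ words n with C l, w l

theorem gf_congr {w : List ℕ → R} {C D : List ℕ → Prop} (h : ∀ l, IsPerm l → (C l ↔ D l)) :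
    gf w C = gf w D := by
  classical
  ext n
  simp only [gf, PowerSeries.coeff_mk]
  congr 1
  exact Finset.filter_congr fun l hl => h l (mem_words.1 hl).1

theorem gf_or {w : List ℕ → R} {C D : List ℕ → Prop} (h : ∀ l, IsPerm l → C l → ¬ D l) :
    gf w (fun l => C l ∨ D l) = gf w C + gf w D := by
  classical
  ext n
  simp only [gf, PowerSeries.coeff_mk, map_add]
  rw [Finset.filter_or, Finset.sum_union]
  exact Finset.disjoint_filter.2 fun l hl => h l (mem_words.1 hl).1

theorem gf_eq_singleton (w : List ℕ → R) {α : List ℕ} (h : IsPerm α) :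
    gf w (· = α) = PowerSeries.C (w α) * PowerSeries.X ^ α.length := by
  classical
  ext n
  simp only [gf, PowerSeries.coeff_mk, PowerSeries.coeff_C_mul, PowerSeries.coeff_X_pow]
  rw [Finset.filter_eq']
  simp only [mem_words, h, true_and]
  by_cases hn : α.length = n
  · simp [hn]
  · simp [hn, Ne.symm hn]

/-- The words obtained by a binary operation from permutations of two given classes. -/
def Join (op : List ℕ → List ℕ → List ℕ) (K S : List ℕ → Prop) (l : List ℕ) : Prop :=
  ∃ c τ, IsPerm c ∧ IsPerm τ ∧ K c ∧ S τ ∧ l = op c τ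

/-- The product rule: if an operation adds lengths, is injective and multiplies weights, then it
multiplies generating functions. -/
theorem gf_join {op : List ℕ → List ℕ → List ℕ} {K S : List ℕ → Prop} {w w₁ w₂ : List ℕ → R}
    {e : R} (hlen : ∀ c τ, (op c τ).length = c.length + τ.length)
    (hperm : ∀ c τ, IsPerm c → IsPerm τ → IsPerm (op c τ))
    (hinj : ∀ c τ c' τ', IsPerm c → IsPerm τ → IsPerm c' → IsPerm τ' → K c → S τ → K c' → S τ' →
      op c τ = op c' τ' → c = c' ∧ τ = τ')
    (hw : ∀ c τ, IsPerm c → IsPerm τ → K c → S τ → w (op c τ) = e * w₁ c * w₂ τ) :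
    gf w (Join op K S) = PowerSeries.C e * gf w₁ K * gf w₂ S := by
  classical
  ext n
  rw [mul_assoc, PowerSeries.coeff_C_mul, PowerSeries.coeff_mul]
  simp only [gf, PowerSeries.coeff_mk, Finset.sum_mul_sum, ← Finset.sum_product']
  rw [Finset.sum_sigma', Finset.mul_sum]
  symm
  refine Finset.sum_nbij (fun x => op x.2.1 x.2.2) ?_ ?_ ?_ ?_
  · rintro ⟨⟨i, j⟩, c, τ⟩ hx
    simp only [mem_sigma, HasAntidiagonal.mem_antidiagonal, mem_product, mem_filter,
      mem_words] at hx ⊢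
    obtain ⟨hn, ⟨⟨hc, hci⟩, hK⟩, ⟨hτ, hτj⟩, hS⟩ := hx
    exact ⟨⟨hperm c τ hc hτ, by rw [hlen]; omega⟩, c, τ, hc, hτ, hK, hS, rfl⟩
  · rintro ⟨⟨i, j⟩, c, τ⟩ hx ⟨⟨i', j'⟩, c', τ'⟩ hx' h
    simp only [coe_sigma, Set.mem_sigma_iff, mem_coe, HasAntidiagonal.mem_antidiagonal,
      mem_product, mem_filter, mem_words] at hx hx'
    obtain ⟨hn, ⟨⟨hc, rfl⟩, hK⟩, ⟨hτ, rfl⟩, hS⟩ := hx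
    obtain ⟨hn', ⟨⟨hc', rfl⟩, hK'⟩, ⟨hτ', rfl⟩, hS'⟩ := hx'
    obtain ⟨rfl, rfl⟩ := hinj c τ c' τ' hc hτ hc' hτ' hK hS hK' hS' h
    rfl
  · intro l hl
    simp only [coe_filter, mem_words, Set.mem_ofPred_eq] at hl
    obtain ⟨⟨-, hn⟩, c, τ, hc, hτ, hK, hS, rfl⟩ := hl
    refine ⟨⟨(c.length, τ.length), c, τ⟩, ?_, rfl⟩
    simp only [coe_sigma, Set.mem_sigma_iff, mem_coe, HasAntidiagonal.mem_antidiagonal,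
      mem_product, mem_filter, mem_words]
    exact ⟨by rw [← hn, hlen], ⟨⟨hc, trivial⟩, hK⟩, ⟨hτ, trivial⟩, hS⟩
  · rintro ⟨⟨i, j⟩, c, τ⟩ hx
    simp only [mem_sigma, HasAntidiagonal.mem_antidiagonal, mem_product, mem_filter,
      mem_words] at hx ⊢
    obtain ⟨hn, ⟨⟨hc, hci⟩, hK⟩, ⟨hτ, hτj⟩, hS⟩ := hx
    rw [hw c τ hc hτ hK hS]
    ring

theorem gf_join_skew (p q u v s t : R) {K S : List ℕ → Prop} (hK : ∀ l, K l → SkewIndec l)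
    (hS : ∀ l, S l → l ≠ []) :
    gf (wt p q u v s t) (Join skew K S) =
      PowerSeries.C q * gf (wt p q u v s 1) K * gf (wt p q 1 v s t) S :=
  gf_join length_skew (fun _ _ h h' => h.skew h')
    (fun _ _ _ _ _ h _ h' k _ k' _ e => skew_inj (hK _ k) (hK _ k') h h' e)
    (fun _ _ _ h k k' => wt_skew p q u v s t (hK _ k).1 (hS _ k') h)

theorem gf_join_dsum (p q u v s t : R) {α : List ℕ} {S : List ℕ → Prop} (h : IsPerm α)
    (h0 : α ≠ []) (hS : ∀ l, S l → l ≠ []) :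
    gf (wt p q u v s t) (Join dsum (· = α) S) =
      PowerSeries.C (p * wt p q u 1 s t α) * PowerSeries.X ^ α.length *
        gf (wt p q u v 1 t) S := by
  rw [gf_join (e := p) (w₁ := wt p q u 1 s t) (w₂ := wt p q u v 1 t) length_dsum
    (fun _ _ h h' => h.dsum h'), gf_eq_singleton _ h, map_mul]
  · ring
  · rintro _ τ _ τ' - - - - rfl - rfl - e
    exact ⟨rfl, List.map_injective_iff.2 (add_left_injective _) (List.append_cancel_left e)⟩
  · rintro _ τ h - rfl k
    exact wt_dsum p q u v s t h0 (hS _ k) h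

/-! ### The recursive structure of the three classes -/

/-- A nonempty word of the class `A` is one of its possible first skew components, or the skew sum
of such a component and a nonempty word of the class. -/
theorem gf_nonempty {A K : List ℕ → Prop} (p q u v s t : R)
    (hmap : ∀ l k, A (l.map (· + k)) ↔ A l) (hKmap : ∀ l k, K (l.map (· + k)) → K l)
    (happ : ∀ l m : List ℕ, (∀ a ∈ l, ∀ b ∈ m, b < a) → (A (l ++ m) ↔ A l ∧ A m))
    (hK : ∀ l, K l → SkewIndec l) (hKA : ∀ l, l.Nodup → K l → A l)
    (hex : ∀ l, l.Nodup → l ≠ [] → A l →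
      ∃ c τ, l = c ++ τ ∧ (∀ a ∈ c, ∀ b ∈ τ, b < a) ∧ K c ∧ A τ) :
    gf (wt p q u v s t) (fun l => A l ∧ l ≠ []) = gf (wt p q u v s t) K +
      PowerSeries.C q * gf (wt p q u v s 1) K *
        gf (wt p q 1 v s t) (fun l => A l ∧ l ≠ []) := by
  rw [← gf_join_skew p q u v s t hK (fun _ h => h.2), ← gf_or]
  · refine gf_congr fun l hl => ⟨fun ⟨hA, h0⟩ => ?_, ?_⟩
    · obtain ⟨c, τ, rfl, hcτ, hc, hτ⟩ := hex l hl.1 h0 hA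
      by_cases hτ0 : τ = []
      · subst hτ0
        exact .inl (by simpa using hc)
      · obtain ⟨hτp, c, hcp, rfl⟩ := hl.split hcτ
        exact .inr ⟨c, τ, hcp, hτp, hKmap _ _ hc, ⟨hτ, hτ0⟩, rfl⟩
    · rintro (h | ⟨c, τ, hcp, hτp, hc, hτ, rfl⟩)
      · exact ⟨hKA l hl.1 h, (hK l h).1⟩
      · refine ⟨(happ _ _ (lt_of_mem_shift hτp)).2 ⟨(hmap _ _).2 (hKA c hcp.1 hc), hτ.1⟩, ?_⟩
        simp [skew, hτ.2]
  · rintro l - hl ⟨c, τ, hcp, hτp, hc, hτ, rfl⟩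
    obtain ⟨x, hx, y, hy, hxy⟩ := (hK _ hl).2 _ _ rfl (by simpa using (hK _ hc).1) hτ.2
    have := lt_of_mem_shift hτp x hx y hy
    omega

theorem Comp2.of_map {l : List ℕ} {k : ℕ} (h : Comp2 (l.map (· + k))) : Comp2 l := by
  obtain ⟨a, e⟩ := h
  obtain ⟨b, rfl, -⟩ := List.map_eq_singleton_iff.1 e
  exact ⟨b, rfl⟩

theorem exists_cons_of_map {P : List ℕ → Prop} (hP : ∀ l k, P (l.map (· + k)) → P l)
    {l : List ℕ} {k : ℕ} (h : ∃ a β, l.map (· + k) = a :: β ∧ β ≠ [] ∧ (∀ b ∈ β, a < b) ∧ P β) :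
    ∃ a β, l = a :: β ∧ β ≠ [] ∧ (∀ b ∈ β, a < b) ∧ P β := by
  obtain ⟨a, β, e, h0, h1, h2⟩ := h
  obtain ⟨a, β, rfl, rfl, rfl⟩ := List.map_eq_cons_iff.1 e
  exact ⟨a, β, rfl, by simpa using h0, by simpa using h1, hP _ _ h2⟩

theorem Comp3.of_map {l : List ℕ} {k : ℕ} (h : Comp3 (l.map (· + k))) : Comp3 l :=
  h.imp Comp2.of_map (exists_cons_of_map fun _ _ => avoid2_map.1)

theorem Comp4.of_map {l : List ℕ} {k : ℕ} (h : Comp4 (l.map (· + k))) : Comp4 l := by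
  refine h.imp Comp2.of_map (.imp (exists_cons_of_map fun _ _ => avoid3_map.1) ?_)
  rintro ⟨a, b, δ, e, h0, hab, h1, h2⟩
  obtain ⟨a, m, rfl, rfl, e'⟩ := List.map_eq_cons_iff.1 e
  obtain ⟨b, δ, rfl, rfl, rfl⟩ := List.map_eq_cons_iff.1 e'
  exact ⟨a, b, δ, rfl, by simpa using h0, by simpa using hab, by simpa using h1, avoid2_map.1 h2⟩

theorem isPerm_zero : IsPerm [0] := by simp [IsPerm]

theorem isPerm_one_zero : IsPerm [1, 0] := by simp [IsPerm]

theorem IsPerm.split_of_lt {l m : List ℕ} (h : IsPerm (l ++ m)) (hlm : ∀ a ∈ l, ∀ b ∈ m, a < b) :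
    IsPerm l ∧ ∃ c, IsPerm c ∧ m = c.map (· + l.length) :=
  (h.perm List.perm_append_comm).split fun a ha b hb => hlm b hb a ha

theorem comp2_iff {l : List ℕ} (hl : IsPerm l) : Comp2 l ↔ l = [0] := by
  constructor
  · rintro ⟨a, rfl⟩
    simpa [IsPerm] using hl
  · rintro rfl
    exact ⟨0, rfl⟩

theorem exists_cons_iff_join {P : List ℕ → Prop} (hP : ∀ l k, P (l.map (· + k)) ↔ P l)
    {l : List ℕ} (hl : IsPerm l) :
    (∃ a β, l = a :: β ∧ β ≠ [] ∧ (∀ b ∈ β, a < b) ∧ P β) ↔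
      Join dsum (· = [0]) (fun β => P β ∧ β ≠ []) l := by
  constructor
  · rintro ⟨a, β, rfl, h0, h1, h2⟩
    obtain ⟨ha, c, hc, rfl⟩ := hl.split_of_lt (l := [a]) (m := β) (by simpa using h1)
    obtain rfl : a = 0 := by simpa [IsPerm] using ha
    exact ⟨[0], c, isPerm_zero, hc, rfl, ⟨(hP _ _).1 h2, by simpa using h0⟩, rfl⟩
  · rintro ⟨_, β, -, hβ, rfl, ⟨h1, h2⟩, rfl⟩
    exact ⟨0, β.map (· + 1), rfl, by simpa using h2, by simp, (hP _ _).2 h1⟩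

theorem comp3_iff {l : List ℕ} (hl : IsPerm l) :
    Comp3 l ↔ l = [0] ∨ Join dsum (· = [0]) (fun β => Avoid2 β ∧ β ≠ []) l :=
  or_congr (comp2_iff hl) (exists_cons_iff_join (fun _ _ => avoid2_map) hl)

theorem comp4_iff {l : List ℕ} (hl : IsPerm l) :
    Comp4 l ↔ l = [0] ∨ Join dsum (· = [0]) (fun β => Avoid3 β ∧ β ≠ []) l ∨
      Join dsum (· = [1, 0]) (fun β => Avoid2 β ∧ β ≠ []) l := by
  refine or_congr (comp2_iff hl)
    (or_congr (exists_cons_iff_join (fun _ _ => avoid3_map) hl) ⟨?_, ?_⟩)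
  · rintro ⟨a, b, δ, rfl, h0, hab, h1, h2⟩
    obtain ⟨ha, c, hc, rfl⟩ := hl.split_of_lt (l := [a, b]) (m := δ) (by
      intro x hx y hy
      have := h1 y hy
      simp at hx
      omega)
    have ha' := ha.2
    simp at ha'
    obtain ⟨rfl, rfl⟩ : a = 1 ∧ b = 0 := by omega
    exact ⟨[1, 0], c, isPerm_one_zero, hc, rfl, ⟨avoid2_map.1 h2, by simpa using h0⟩, rfl⟩
  · rintro ⟨_, δ, -, hδ, rfl, ⟨h1, h2⟩, rfl⟩
    exact ⟨1, 0, δ.map (· + 2), rfl, by simpa using h2, by simp, by simp, avoid2_map.2 h1⟩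

theorem wt_zero (p q u v s t : R) : wt p q u v s t [0] = u * v * s * t := by
  simp [wt, adjCount, records]

theorem wt_one_zero (p q u v s t : R) :
    wt p q u v s t [1, 0] = q * u * v ^ 2 * s ^ 2 * t := by
  simp [wt, adjCount, records]

open PowerSeries (X) in
theorem gf_comp2 (p q u v s t : R) :
    gf (wt p q u v s t) Comp2 = PowerSeries.C (u * v * s * t) * X := by
  rw [gf_congr fun _ => comp2_iff, gf_eq_singleton _ isPerm_zero, wt_zero]
  simp

theorem ne_singleton_of_join {α : List ℕ} {S : List ℕ → Prop} (h0 : α ≠ [])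
    (hS : ∀ l, S l → l ≠ []) {l : List ℕ} (h : Join dsum (· = α) S l) (a : ℕ) : l ≠ [a] := by
  rintro rfl
  obtain ⟨_, τ, -, -, rfl, h2, e⟩ := h
  have e := congrArg List.length e
  rw [length_dsum] at e
  have h3 := List.length_pos_iff.2 (hS τ h2)
  have h4 := List.length_pos_iff.2 h0
  simp only [List.length_singleton] at e
  omega

open PowerSeries (X) in
theorem gf_comp3 (p q u v s t : R) :
    gf (wt p q u v s t) Comp3 = PowerSeries.C (u * v * s * t) * X +
      PowerSeries.C (p * (u * s * t)) * X *
        gf (wt p q u v 1 t) (fun l => Avoid2 l ∧ l ≠ []) := by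
  rw [gf_congr fun _ => comp3_iff, gf_or, gf_eq_singleton _ isPerm_zero, wt_zero,
    gf_join_dsum p q u v s t isPerm_zero (by simp) (fun _ h => h.2), wt_zero]
  · simp
  · rintro l - rfl h
    exact ne_singleton_of_join (by simp) (fun _ h => h.2) h 0 rfl

open PowerSeries (X) in
theorem gf_comp4 (p q u v s t : R) :
    gf (wt p q u v s t) Comp4 = PowerSeries.C (u * v * s * t) * X +
      (PowerSeries.C (p * (u * s * t)) * X *
          gf (wt p q u v 1 t) (fun l => Avoid3 l ∧ l ≠ []) +
        PowerSeries.C (p * (q * u * s ^ 2 * t)) * X ^ 2 *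
          gf (wt p q u v 1 t) (fun l => Avoid2 l ∧ l ≠ [])) := by
  rw [gf_congr fun _ => comp4_iff, gf_or, gf_or, gf_eq_singleton _ isPerm_zero, wt_zero,
    gf_join_dsum p q u v s t isPerm_zero (by simp) (fun _ h => h.2), wt_zero,
    gf_join_dsum p q u v s t isPerm_one_zero (by simp) (fun _ h => h.2), wt_one_zero]
  · simp
  · rintro l - ⟨_, β, -, -, rfl, h1, rfl⟩ ⟨_, δ, -, -, rfl, h2, e⟩
    simp [dsum] at e
  · rintro l - rfl (h | h)
    · exact ne_singleton_of_join (by simp) (fun _ h => h.2) h 0 rfl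
    · exact ne_singleton_of_join (by simp) (fun _ h => h.2) h 0 rfl

theorem gf_avoid2 (p q u v s t : R) :
    gf (wt p q u v s t) (fun l => Avoid2 l ∧ l ≠ []) = gf (wt p q u v s t) Comp2 +
      PowerSeries.C q * gf (wt p q u v s 1) Comp2 *
        gf (wt p q 1 v s t) (fun l => Avoid2 l ∧ l ≠ []) :=
  gf_nonempty p q u v s t (fun _ _ => avoid2_map) (fun _ _ => Comp2.of_map)
    (fun _ _ => avoid2_append) (fun _ => Comp2.skewIndec) (fun _ _ => Comp2.avoid2)
    (fun _ _ h0 h => h.exists_comp h0)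

theorem gf_avoid3 (p q u v s t : R) :
    gf (wt p q u v s t) (fun l => Avoid3 l ∧ l ≠ []) = gf (wt p q u v s t) Comp3 +
      PowerSeries.C q * gf (wt p q u v s 1) Comp3 *
        gf (wt p q 1 v s t) (fun l => Avoid3 l ∧ l ≠ []) :=
  gf_nonempty p q u v s t (fun _ _ => avoid3_map) (fun _ _ => Comp3.of_map)
    (fun _ _ => avoid3_append) (fun _ => Comp3.skewIndec) (fun _ hn h => h.avoid3 hn)
    (fun _ hn h0 h => h.exists_comp hn h0)

theorem gf_avoid4 (p q u v s t : R) :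
    gf (wt p q u v s t) (fun l => Avoid4 l ∧ l ≠ []) = gf (wt p q u v s t) Comp4 +
      PowerSeries.C q * gf (wt p q u v s 1) Comp4 *
        gf (wt p q 1 v s t) (fun l => Avoid4 l ∧ l ≠ []) :=
  gf_nonempty p q u v s t (fun _ _ => avoid4_map) (fun _ _ => Comp4.of_map)
    (fun _ _ => avoid4_append) (fun _ => Comp4.skewIndec) (fun _ hn h => h.avoid4 hn)
    (fun _ hn h0 h => h.exists_comp hn h0)

/-! ### The generating function of the avoiders -/

/-- Subsequences given by increasing positions are sublists. -/
theorem exists_strictMono_iff {n k : ℕ} (g : Fin n → ℕ) (P : (Fin k → ℕ) → Prop) :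
    (∃ f : Fin k → Fin n, (∀ i j, i < j → f i < f j) ∧ P (fun i => g (f i))) ↔
      ∃ x : Fin k → ℕ, (List.ofFn x).Sublist (List.ofFn g) ∧ P x := by
  constructor
  · rintro ⟨f, hf, h⟩
    refine ⟨_, List.sublist_iff_exists_fin_orderEmbedding_get_eq.2 ⟨OrderEmbedding.ofStrictMono
      (fun i => (f (i.cast List.length_ofFn)).cast List.length_ofFn.symm) ?_, ?_⟩, h⟩
    · intro i j hij
      exact hf (i.cast List.length_ofFn) (j.cast List.length_ofFn) hij
    · intro i
      simp
      rfl
  · rintro ⟨x, hx, h⟩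
    obtain ⟨f, hf⟩ := List.sublist_iff_exists_fin_orderEmbedding_get_eq.1 hx
    have hk : k = (List.ofFn x).length := List.length_ofFn.symm
    refine ⟨fun i => (f (i.cast hk)).cast List.length_ofFn, fun i j hij => ?_, ?_⟩
    · have hij' : i.cast hk < j.cast hk := hij
      exact f.strictMono hij'
    · convert h using 2 with i
      have := hf (i.cast hk)
      simp at this
      rw [this]
      rfl

theorem contains_iff {n k : ℕ} (π : Equiv.Perm (Fin n)) (w : Fin k → ℕ) :
    Contains π w ↔ ∃ x : Fin k → ℕ, (List.ofFn x).Sublist (word π) ∧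
      ∀ i j, x i < x j ↔ w i < w j :=
  exists_strictMono_iff (fun i => (π i : ℕ)) (fun x => ∀ i j, x i < x j ↔ w i < w j)

theorem containsPOP_iff {n k : ℕ} (π : Equiv.Perm (Fin n)) (r : Fin k → Fin k → Prop) :
    ContainsPOP π r ↔ ∃ x : Fin k → ℕ, (List.ofFn x).Sublist (word π) ∧
      ∀ i j, r i j → x i < x j :=
  exists_strictMono_iff (fun i => (π i : ℕ)) (fun x => ∀ i j, r i j → x i < x j)

theorem mem_avoiders_iff {n : ℕ} (π : Equiv.Perm (Fin n)) :
    π ∈ avoiders 4 n ↔ Avoid4 (word π) := by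
  simp only [avoiders, mem_filter, mem_univ, true_and, contains_iff, containsPOP_iff, not_exists,
    not_and]
  constructor
  · rintro ⟨h1, h2, h3⟩ a b c d H
    have H' : (List.ofFn ![a, b, c, d]).Sublist (word π) := by simpa using H
    have h1 := h1 _ H'
    have h2 := h2 _ H'
    have h3 := h3 _ H'
    simp [Fin.forall_fin_succ, popP] at h1 h2 h3
    omega
  · intro h
    refine ⟨fun x hx e => ?_, fun x hx e => ?_, fun x hx e => ?_⟩ <;>
    · have h' := h (x 0) (x 1) (x 2) (x 3) (by simpa [List.ofFn_succ] using hx)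
      simp [Fin.forall_fin_succ, popP] at e
      simp at h'
      omega

theorem wt_word (p q u v s t : R) {n : ℕ} (π : Equiv.Perm (Fin n)) :
    wt p q u v s t (word π) =
      p ^ asc π * q ^ des π * u ^ lrmax π * v ^ rlmax π * s ^ lrmin π * t ^ rlmin π := by
  simp only [wt, word, ← card_filter_adjacent, ← card_filter_records,
    ← card_filter_records_reverse]
  rfl

theorem genF_eq_gf (p q u v s t : R) :
    genF 4 p q u v s t = gf (wt p q u v s t) Avoid4 := by
  classical
  ext n
  simp only [genF, gf, PowerSeries.coeff_mk]
  rw [words, Finset.filter_image, Finset.sum_image word_injective.injOn]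
  refine Finset.sum_congr ?_ fun π _ => (wt_word p q u v s t π).symm
  ext π
  simp [mem_avoiders_iff]

theorem genF_eq (p q u v s t : R) :
    genF 4 p q u v s t = 1 + gf (wt p q u v s t) (fun l => Avoid4 l ∧ l ≠ []) := by
  have h0 : IsPerm [] := by simp [IsPerm]
  have h : gf (wt p q u v s t) (· = []) = 1 := by
    rw [gf_eq_singleton _ h0]
    simp [wt, adjCount, records]
  rw [genF_eq_gf, ← h, ← gf_or (by simp +contextual)]
  refine gf_congr fun l _ => ?_
  by_cases hl : l = []
  · simp [hl, Avoid4]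
  · simp [hl]

end

/-! ### Elimination -/

section Algebra

variable {S : Type*} [CommRing S]

/-- The denominator of the generating function of the decreasing words. -/
def den2 (x q v : S) : S := 1 - q * v * x

/-- The other factor, besides `den2`, of the denominator of the generating function of `Avoid3`
at `s = 1`. -/
def den3 (x p q v : S) : S := den2 x q v ^ 2 - p * q * v * x ^ 2

/-- The numerator over `den2 * den3` of the generating function of `Avoid3` at `s = 1`. -/
def num3 (x p q u v t : S) : S :=
  u * v * t * x * (den2 x q v + p * u * t * x) * den3 x p q v +
    q * u * v * x * (den2 x q v + p * u * x) * (t * v * x * (den2 x q v + p * t * x))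

/-- The numerator over `den2 * den3` of the generating function of `Comp4`, the first skew
components of the avoiders of `P_4`. -/
def num4 (x p q u v s t : S) : S :=
  u * v * s * t * x * den2 x q v * den3 x p q v + p * u * s * t * x * num3 x p q u v t +
    p * q * u * s ^ 2 * t * x ^ 2 * (u * v * t * x) * den3 x p q v

/-- Up to the denominators, `F_b` is the factor `1 - q * gf Comp4` at `u = t = 1` that inverting
the skew-sum recursion puts in the denominator. -/
theorem Fb_eq (x p q u v s t : S) :
    Fb x p q u v s t = den2 x q v * den3 x p q v - q * num4 x p q 1 v s 1 := by
  simp only [Fb, num4, num3, den3, den2]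
  ring

/-- The polynomial identity left after elimination, with the denominators cleared. -/
theorem den_mul_Fa (x p q u v s t : S) :
    den2 x q v * den3 x p q v * Fa x p q u v s t =
      den2 x q v * den3 x p q v * Fb x p q u v s t + Fb x p q u v s t * num4 x p q u v s t +
        q * num4 x p q u v s 1 * num4 x p q 1 v s t := by
  simp only [Fa, Fb, num4, num3, den3, den2]
  ring

end Algebra

section

variable {R : Type*} [CommRing R] (p q u v s t : R)

open PowerSeries (X C)

theorem den2_mul_gf (u t : R) :
    den2 X (C q) (C v) * gf (wt p q u v 1 t) (fun l => Avoid2 l ∧ l ≠ []) =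
      C u * C v * C t * X := by
  have h1 := gf_avoid2 p q u v 1 t
  have h2 := gf_avoid2 p q 1 v 1 t
  simp only [gf_comp2, map_mul, mul_one, one_mul] at h1 h2
  rw [den2]
  linear_combination (1 - C q * C v * X) * h1 + C q * C u * C v * X * h2

theorem den2_mul_gf_comp3 (u t : R) :
    den2 X (C q) (C v) * gf (wt p q u v 1 t) Comp3 =
      C u * C v * C t * X * (den2 X (C q) (C v) + C p * C u * C t * X) := by
  rw [gf_comp3]
  simp only [map_mul, mul_one]
  linear_combination C p * C u * C t * X * den2_mul_gf p q v u t

/-- At `u = s = 1` the factor `den2` cancels. -/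
theorem den3_mul_gf (t : R) :
    den3 X (C p) (C q) (C v) * gf (wt p q 1 v 1 t) (fun l => Avoid3 l ∧ l ≠ []) =
      C t * C v * X * (den2 X (C q) (C v) + C p * C t * X) := by
  have h1 := gf_avoid3 p q 1 v 1 t
  have h2 := den2_mul_gf_comp3 p q v 1 t
  have h3 := den2_mul_gf_comp3 p q v 1 1
  simp only [map_one, mul_one, one_mul] at h2 h3
  rw [den3]
  set D := den2 X (C q) (C v) with hD
  have hD' : D = 1 - C q * C v * X := hD
  linear_combination D * h1 + h2 + C q * gf (wt p q 1 v 1 t) (fun l => Avoid3 l ∧ l ≠ []) * h3 +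
    D * gf (wt p q 1 v 1 t) (fun l => Avoid3 l ∧ l ≠ []) * hD'

theorem den2_mul_den3_mul_gf (u t : R) :
    den2 X (C q) (C v) * den3 X (C p) (C q) (C v) *
        gf (wt p q u v 1 t) (fun l => Avoid3 l ∧ l ≠ []) =
      num3 X (C p) (C q) (C u) (C v) (C t) := by
  have h1 := gf_avoid3 p q u v 1 t
  have h2 := den2_mul_gf_comp3 p q v u t
  have h3 := den2_mul_gf_comp3 p q v u 1
  have h4 := den3_mul_gf p q v t
  simp only [map_one, mul_one] at h3
  rw [num3]
  set D := den2 X (C q) (C v)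
  set E := den3 X (C p) (C q) (C v)
  linear_combination D * E * h1 + E * h2 +
    C q * E * gf (wt p q 1 v 1 t) (fun l => Avoid3 l ∧ l ≠ []) * h3 +
    C q * C u * C v * X * (D + C p * C u * X) * h4

theorem den2_mul_den3_mul_gf_comp4 (u t : R) :
    den2 X (C q) (C v) * den3 X (C p) (C q) (C v) * gf (wt p q u v s t) Comp4 =
      num4 X (C p) (C q) (C u) (C v) (C s) (C t) := by
  have h2 := den2_mul_gf p q v u t
  have h3 := den2_mul_den3_mul_gf p q v u t
  rw [gf_comp4, num4]
  simp only [map_mul, map_pow]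
  linear_combination C p * C u * C s * C t * X * h3 +
    C p * C q * C u * C s ^ 2 * C t * X ^ 2 * den3 X (C p) (C q) (C v) * h2

theorem isUnit_den : IsUnit (den2 X (C q) (C v) * den3 X (C p) (C q) (C v)) := by
  rw [PowerSeries.isUnit_iff_constantCoeff]
  simp [den2, den3]

theorem isUnit_Fb : IsUnit (Fb X (C p) (C q) (C u) (C v) (C s) (C t)) := by
  rw [PowerSeries.isUnit_iff_constantCoeff]
  simp [Fb]

theorem genF_mul_Fb :
    genF 4 p q u v s t * Fb X (C p) (C q) (C u) (C v) (C s) (C t) =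
      Fa X (C p) (C q) (C u) (C v) (C s) (C t) := by
  apply (isUnit_den p q v).mul_left_cancel
  have h1 := gf_avoid4 p q u v s t
  have h2 := gf_avoid4 p q 1 v s t
  have k1 := den2_mul_den3_mul_gf_comp4 p q v s u t
  have k2 := den2_mul_den3_mul_gf_comp4 p q v s u 1
  have k3 := den2_mul_den3_mul_gf_comp4 p q v s 1 t
  have k4 := den2_mul_den3_mul_gf_comp4 p q v s 1 1
  have hb := Fb_eq X (C p) (C q) (C u) (C v) (C s) (C t)
  rw [den_mul_Fa, genF_eq]
  simp only [map_one] at k2 k3 k4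
  set D := den2 X (C q) (C v)
  set E := den3 X (C p) (C q) (C v)
  set B := Fb X (C p) (C q) (C u) (C v) (C s) (C t)
  set f := gf (wt p q 1 v s t) (fun l => Avoid4 l ∧ l ≠ [])
  -- the generating function at `u = 1` has the denominator `B` alone
  have h3 : B * f = num4 X (C p) (C q) 1 (C v) (C s) (C t) := by
    linear_combination f * hb + D * E * h2 + k3 + C q * f * k4
  linear_combination D * E * B * h1 + B * k1 + C q * B * f * k2 +
    C q * num4 X (C p) (C q) (C u) (C v) (C s) 1 * h3

end

/-! ### The number of monomials -/

/-- The data of a monomial in seven variables: its coefficient, then its exponents. -/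
abbrev Term := ℤ × ℕ × ℕ × ℕ × ℕ × ℕ × ℕ × ℕ

/-- The value of a monomial. -/
def Term.eval {S : Type*} [CommRing S] (x p q u v s t : S) : Term → S
  | (c, i₀, i₁, i₂, i₃, i₄, i₅, i₆) =>
    c * x ^ i₀ * p ^ i₁ * q ^ i₂ * u ^ i₃ * v ^ i₄ * s ^ i₅ * t ^ i₆

/-- The exponent vector of a monomial. -/
noncomputable def Term.exponent : Term → Fin 7 →₀ ℕ
  | (_, i₀, i₁, i₂, i₃, i₄, i₅, i₆) =>
    Finsupp.equivFunOnFinite.symm ![i₀, i₁, i₂, i₃, i₄, i₅, i₆]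

theorem Term.exponent_eq_iff {a b : Term} : a.exponent = b.exponent ↔ a.2 = b.2 := by
  obtain ⟨_, _, _, _, _, _, _, _⟩ := a
  obtain ⟨_, _, _, _, _, _, _, _⟩ := b
  simp [Term.exponent, ← List.ofFn_inj]

open MvPolynomial in
theorem Term.eval_X (a : Term) :
    a.eval (X 0) (X 1) (X 2) (X 3) (X 4) (X 5) (X 6) =
      (monomial a.exponent a.1 : MvPolynomial (Fin 7) ℤ) := by
  obtain ⟨c, _, _, _, _, _, _, _⟩ := a
  rw [MvPolynomial.monomial_eq, Finsupp.prod_fintype _ _ (by simp)]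
  simp [Term.eval, Term.exponent, Fin.prod_univ_succ, mul_assoc]

open MvPolynomial in
theorem card_support_sum_eval (L : List Term) (h : (L.map Prod.snd).Nodup)
    (h0 : ∀ a ∈ L, a.1 ≠ 0) :
    (L.map (Term.eval (X 0) (X 1) (X 2) (X 3) (X 4) (X 5) (X 6) :
      Term → MvPolynomial (Fin 7) ℤ)).sum.support.card =
      L.length := by
  classical
  have key : (L.map (Term.eval (X 0) (X 1) (X 2) (X 3) (X 4) (X 5) (X 6) :
      Term → MvPolynomial (Fin 7) ℤ)).sum.support = (L.map Term.exponent).toFinset ∧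
      (L.map Term.exponent).Nodup := by
    induction L with
    | nil => simp
    | cons a L ih =>
      simp only [List.map_cons, List.nodup_cons, List.forall_mem_cons] at h h0
      obtain ⟨ih, hn⟩ := ih h.2 h0.2
      have ha : a.exponent ∉ L.map Term.exponent := by
        intro H
        obtain ⟨b, hb, e⟩ := List.mem_map.1 H
        exact h.1 (List.mem_map.2 ⟨b, hb, Term.exponent_eq_iff.1 e⟩)
      refine ⟨?_, List.nodup_cons.2 ⟨ha, hn⟩⟩
      rw [List.map_cons, List.sum_cons, Term.eval_X, List.map_cons, List.toFinset_cons, ← ih]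
      ext m
      rw [mem_support_iff, coeff_add, coeff_monomial, Finset.mem_insert, mem_support_iff]
      by_cases hm : a.exponent = m
      · have : coeff m (L.map (Term.eval (X 0) (X 1) (X 2) (X 3) (X 4) (X 5) (X 6) :
            Term → MvPolynomial (Fin 7) ℤ)).sum = 0 := by
          rw [← notMem_support_iff, ih, ← hm]
          simpa using ha
        simp [hm, this, h0.1]
      · simp [hm, Ne.symm hm]
  rw [key.1, List.toFinset_card_of_nodup key.2, List.length_map]

/-- The monomials of the expanded denominator. -/
def termsFb : List Term :=
   [(1, 0, 0, 0, 0, 0, 0, 0), (-3, 1, 0, 1, 0, 1, 0, 0), (-1, 1, 0, 1, 0, 1, 1, 0),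
    (3, 2, 0, 2, 0, 2, 0, 0), (3, 2, 0, 2, 0, 2, 1, 0), (-1, 2, 1, 1, 0, 1, 0, 0),
    (-1, 2, 1, 1, 0, 1, 1, 0), (-1, 3, 0, 3, 0, 3, 0, 0), (-3, 3, 0, 3, 0, 3, 1, 0),
    (-1, 3, 1, 2, 0, 1, 2, 0), (1, 3, 1, 2, 0, 2, 0, 0), (3, 3, 1, 2, 0, 2, 1, 0),
    (-1, 3, 2, 1, 0, 1, 1, 0), (1, 4, 0, 4, 0, 4, 1, 0), (2, 4, 1, 3, 0, 2, 2, 0),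
    (-2, 4, 1, 3, 0, 3, 1, 0), (1, 4, 2, 2, 0, 2, 1, 0), (-1, 5, 1, 4, 0, 3, 2, 0),
    (1, 5, 2, 3, 0, 2, 2, 0)]

/-- The monomials of the expanded numerator. -/
def termsFa : List Term :=
   [(1, 0, 0, 0, 0, 0, 0, 0), (1, 1, 0, 0, 1, 1, 1, 1), (-3, 1, 0, 1, 0, 1, 0, 0),
    (-1, 1, 0, 1, 0, 1, 1, 0), (-3, 2, 0, 1, 1, 2, 1, 1), (3, 2, 0, 2, 0, 2, 0, 0),
    (3, 2, 0, 2, 0, 2, 1, 0), (1, 2, 1, 0, 2, 1, 1, 2), (-1, 2, 1, 1, 0, 1, 0, 0),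
    (-1, 2, 1, 1, 0, 1, 1, 0), (3, 3, 0, 2, 1, 3, 1, 1), (-1, 3, 0, 3, 0, 3, 0, 0),
    (-3, 3, 0, 3, 0, 3, 1, 0), (-1, 3, 1, 1, 1, 2, 1, 1), (-1, 3, 1, 1, 1, 2, 2, 1),
    (1, 3, 1, 1, 1, 2, 2, 2), (1, 3, 1, 1, 2, 1, 2, 2), (-2, 3, 1, 1, 2, 2, 1, 2),
    (1, 3, 1, 1, 2, 2, 2, 1), (-1, 3, 1, 1, 2, 2, 2, 2), (-1, 3, 1, 2, 0, 1, 2, 0),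
    (1, 3, 1, 2, 0, 2, 0, 0), (3, 3, 1, 2, 0, 2, 1, 0), (1, 3, 2, 0, 3, 1, 1, 3),
    (-1, 3, 2, 1, 0, 1, 1, 0), (-1, 4, 0, 3, 1, 4, 1, 1), (1, 4, 0, 4, 0, 4, 1, 0),
    (-1, 4, 1, 2, 1, 2, 3, 1), (1, 4, 1, 2, 1, 2, 3, 2), (1, 4, 1, 2, 1, 3, 1, 1),
    (2, 4, 1, 2, 1, 3, 2, 1), (-2, 4, 1, 2, 1, 3, 2, 2), (-2, 4, 1, 2, 2, 2, 2, 2),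
    (1, 4, 1, 2, 2, 2, 3, 1), (-1, 4, 1, 2, 2, 2, 3, 2), (1, 4, 1, 2, 2, 3, 1, 2),
    (-2, 4, 1, 2, 2, 3, 2, 1), (2, 4, 1, 2, 2, 3, 2, 2), (2, 4, 1, 3, 0, 2, 2, 0),
    (-2, 4, 1, 3, 0, 3, 1, 0), (-1, 4, 2, 1, 1, 2, 2, 1), (1, 4, 2, 1, 1, 2, 2, 3),
    (-1, 4, 2, 1, 2, 2, 1, 2), (1, 4, 2, 1, 2, 2, 1, 3), (1, 4, 2, 1, 3, 2, 1, 2),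
    (-2, 4, 2, 1, 3, 2, 1, 3), (1, 4, 2, 1, 3, 2, 2, 1), (-1, 4, 2, 1, 3, 2, 2, 3),
    (1, 4, 2, 2, 0, 2, 1, 0), (2, 5, 1, 3, 1, 3, 3, 1), (-2, 5, 1, 3, 1, 3, 3, 2),
    (-1, 5, 1, 3, 1, 4, 2, 1), (1, 5, 1, 3, 1, 4, 2, 2), (1, 5, 1, 3, 2, 3, 2, 2),
    (-2, 5, 1, 3, 2, 3, 3, 1), (2, 5, 1, 3, 2, 3, 3, 2), (1, 5, 1, 3, 2, 4, 2, 1),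
    (-1, 5, 1, 3, 2, 4, 2, 2), (-1, 5, 1, 4, 0, 3, 2, 0), (1, 5, 2, 2, 1, 3, 2, 1),
    (-1, 5, 2, 2, 1, 3, 2, 3), (-1, 5, 2, 2, 2, 2, 2, 2), (1, 5, 2, 2, 2, 3, 1, 2),
    (-1, 5, 2, 2, 2, 3, 1, 3), (1, 5, 2, 2, 2, 3, 2, 2), (-1, 5, 2, 2, 2, 3, 2, 3),
    (-1, 5, 2, 2, 3, 3, 1, 2), (1, 5, 2, 2, 3, 3, 1, 3), (-1, 5, 2, 2, 3, 3, 2, 1),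
    (-1, 5, 2, 2, 3, 3, 2, 2), (2, 5, 2, 2, 3, 3, 2, 3), (1, 5, 2, 3, 0, 2, 2, 0),
    (-1, 5, 3, 1, 2, 2, 2, 2), (1, 5, 3, 1, 2, 2, 2, 3), (1, 5, 3, 1, 3, 2, 2, 2),
    (-1, 5, 3, 1, 3, 2, 2, 3), (-1, 6, 1, 4, 1, 4, 3, 1), (1, 6, 1, 4, 1, 4, 3, 2),
    (1, 6, 1, 4, 2, 4, 3, 1), (-1, 6, 1, 4, 2, 4, 3, 2), (1, 6, 2, 3, 1, 3, 3, 1),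
    (-1, 6, 2, 3, 1, 3, 3, 2), (-1, 6, 2, 3, 2, 3, 3, 1), (1, 6, 2, 3, 2, 3, 3, 2),
    (-1, 6, 2, 3, 2, 4, 2, 2), (1, 6, 2, 3, 2, 4, 2, 3), (1, 6, 2, 3, 3, 4, 2, 2),
    (-1, 6, 2, 3, 3, 4, 2, 3), (-1, 6, 3, 2, 2, 2, 3, 2), (1, 6, 3, 2, 2, 2, 3, 3),
    (1, 6, 3, 2, 2, 3, 2, 2), (-1, 6, 3, 2, 2, 3, 2, 3), (1, 6, 3, 2, 3, 2, 3, 2),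
    (-1, 6, 3, 2, 3, 2, 3, 3), (-1, 6, 3, 2, 3, 3, 2, 2), (1, 6, 3, 2, 3, 3, 2, 3),
    (1, 7, 3, 3, 2, 3, 3, 2), (-1, 7, 3, 3, 2, 3, 3, 3), (-1, 7, 3, 3, 3, 3, 3, 2),
    (1, 7, 3, 3, 3, 3, 3, 3)]

set_option synthInstance.maxSize 1000 in
theorem nodup_termsFb : (termsFb.map Prod.snd).Nodup := by decide +kernel

set_option synthInstance.maxSize 1000 in
theorem nodup_termsFa : (termsFa.map Prod.snd).Nodup := by decide +kernel

theorem Fb_eq_sum {S : Type*} [CommRing S] (x p q u v s t : S) :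
    Fb x p q u v s t = (termsFb.map (Term.eval x p q u v s t)).sum := by
  simp only [Fb, termsFb, List.map_cons, List.map_nil, List.sum_cons, List.sum_nil, Term.eval]
  push_cast
  ring

theorem Fa_eq_sum {S : Type*} [CommRing S] (x p q u v s t : S) :
    Fa x p q u v s t = (termsFa.map (Term.eval x p q u v s t)).sum := by
  simp only [Fa, termsFa, List.map_cons, List.map_nil, List.sum_cons, List.sum_nil, Term.eval]
  push_cast
  ring

end SepPOP

theorem theorem2 :
    (∀ {R : Type*} [CommRing R] (p q u v s t : R),
      IsUnit (SepPOP.Fb PowerSeries.X (PowerSeries.C p) (PowerSeries.C q) (PowerSeries.C u)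
          (PowerSeries.C v) (PowerSeries.C s) (PowerSeries.C t)) ∧
      SepPOP.genF 4 p q u v s t *
          SepPOP.Fb PowerSeries.X (PowerSeries.C p) (PowerSeries.C q) (PowerSeries.C u)
            (PowerSeries.C v) (PowerSeries.C s) (PowerSeries.C t) =
        SepPOP.Fa PowerSeries.X (PowerSeries.C p) (PowerSeries.C q) (PowerSeries.C u)
          (PowerSeries.C v) (PowerSeries.C s) (PowerSeries.C t)) ∧
    (SepPOP.Fa (MvPolynomial.X 0) (MvPolynomial.X 1) (MvPolynomial.X 2) (MvPolynomial.X 3)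
      (MvPolynomial.X 4) (MvPolynomial.X 5) (MvPolynomial.X 6) :
        MvPolynomial (Fin 7) ℤ).support.card = 100 ∧
    (SepPOP.Fb (MvPolynomial.X 0) (MvPolynomial.X 1) (MvPolynomial.X 2) (MvPolynomial.X 3)
      (MvPolynomial.X 4) (MvPolynomial.X 5) (MvPolynomial.X 6) :
        MvPolynomial (Fin 7) ℤ).support.card = 19 := by
  refine ⟨fun p q u v s t => ⟨SepPOP.isUnit_Fb p q u v s t, SepPOP.genF_mul_Fb p q u v s t⟩,
    ?_, ?_⟩
  · rw [SepPOP.Fa_eq_sum, SepPOP.card_support_sum_eval _ SepPOP.nodup_termsFa (by decide +kernel)]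
    rfl
  · rw [SepPOP.Fb_eq_sum, SepPOP.card_support_sum_eval _ SepPOP.nodup_termsFb (by decide +kernel)]
    rfl
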